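/- **Theorem (accuracy estimate for the GIGAQBX algorithm).** *Setting.* Let $\mathcal G(x,y)=\frac1{4\pi\|x-y\|}$ on $\mathbb R^3$, let $\Gamma\subset\mathbb R^3$ be a surface, $\mu:\Gamma\to\mathbb R$ a bounded density, $y_1,\dots,y_N\in\Gamma$ quadrature nodes (sources) with real weights $w_1,\dots,w_N$. With the spherical harmonics $Y_n^m$, the $p$-th order local expansion at $c$ with coefficients $L_n^m$ is $\sum_{n\le p}\sum_{|m|\le n}L_n^m\|t-c\|^nY_n^m(\theta_{t-c},\phi_{t-c})$, with $L_n^m=\frac1{2n+1}\|s-c\|^{-n-1}Y_n^{-m}(\theta_{s-c},\phi_{s-c})$ for a unit source at $s$; the $p$-th order multipole expansion at $c$ is $\sum_{n\le p}\sum_{|m|\le n}M_n^m\|t-c\|^{-n-1}Y_n^{-m}(\theta_{t-c},\phi_{t-c})$, with $M_n^m=\frac1{2n+1}\|s-c\|^{n}Y_n^m(\theta_{s-c},\phi_{s-c})$. The classical multipole-to-multipole, multipole-to-local and local-to-local translations are used. A target $x$ is either associated to a QBX center $c$ of radius $r_c$ with $\|x-c\|\le r_c$, or conventional. $\mathcal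 S_{\mathrm{QBX}(q,N)}\mu(x)$ is the value at $x$ of the $q$-th order local expansion at $c$ of $\sum_iw_i\mu(y_i)\mathcal G(y_i,\cdot)$ in the first case, and $\sum_iw_i\mu(y_i)\mathcal G(y_i,x)$ in the second. *Tree.* Boxes of an octree are cubes; $|b|$ is half the side length of $b$. Fix a target confinement factor $0\le t_f<2\sqrt3-2$. The target confinement region $\mathrm{TCR}(b)$ is the closed Euclidean ball of radius $\sqrt3|b|(1+t_f)$ about the center of $b$. Every source and every conventional target is owned by a leaf box containing it; every QBX center is owned by a box (leaf or not) that contains it and whose TCR contains the closed ball of radius $r_c$ about it. (Octrees obtained by adaptive refinement with any bound on the number of particles per box are of this kind.) The $k$-colleagues of $b$ are the boxes of the same level contained in the closed cube of $\ell^\infty$-radius $|b|(1+2k)$ about the center of $b$ (so $b$ is one of them); boxes of the same level that are not $k$-colleagues are $k$-well-separated; $T_b$ is the set of $2$-colleagues of $b$; boxes are adjacent if they touch (a box is adjacent to itself and to its descendants). Ancestors and descendants are proper. Write $a\prec\mathrm{TCR}(b)$ if the $\ell^2$ distance from the center of $a$ to $\mathrm{TCR}(b)$ is at least $3|a|$,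 and $\mathrm{TCR}(a)\prec b$ if the $\ell^\infty$ distance from the center of $a$ to $b$ is at least $3|a|(1+t_f)$. *Interaction lists of $b$.* List 1: the leaves among $b$, its descendants and the boxes adjacent to $b$. List 2: the children of the $2$-colleagues of the parent of $b$ that are $2$-well-separated from $b$. List 3: the descendants $d$ of boxes in $T_b$ that are not adjacent to $b$ but all of whose ancestors that are descendants of boxes in $T_b$ are adjacent to $b$. List 4: the boxes $d$ owning a source and not adjacent to $b$ which are $2$-colleagues of $b$, or which are $2$-colleagues of an ancestor of $b$ and adjacent to the parent of $b$. Among the boxes of List 3 and their descendants: List 3 close consists of the leaves $d$ with $d\not\prec\mathrm{TCR}(b)$, and List 3 far of the $d\prec\mathrm{TCR}(b)$ such that $w\not\prec\mathrm{TCR}(b)$ for every ancestor $w$ of $d$ among these boxes. List 4 close: the boxes $d$ in List 4 of $b$ or of an ancestor of $b$ with $\mathrm{TCR}(b)\not\prec d$. List 4 far: the boxes $d$ with $\mathrm{TCR}(b)\prec d$ that are in List 4 of $b$ or in List 4 close of its parent. *Algorithm (GIGAQBX FMM of order $p$).* (i) Form order-$p$ multipole expansions of all boxes from the owned sources and, by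 multipole-to-multipole translation, from the children. (ii) The order-$p$ local expansion of a box is the sum of the multipole-to-local translations from List 2, the order-$p$ local expansions due to the sources owned by List 4 far boxes, and the local-to-local translation of the local expansion of its parent. (iii) For a QBX center owned by $b$, the $q$-th order local expansion is the sum of the direct contributions of the sources owned by boxes of Lists 1, 3 close and 4 close of $b$, the translated multipole expansions of List 3 far, and the translated local expansion of $b$; it is evaluated at the associated targets. For a conventional target owned by $b$ the same contributions are evaluated at the target itself. Write $\mathcal G_p[\mathcal S_{\mathrm{QBX}(q,N)}]\mu(x)$ for the result. *Hypotheses.* Assume that there is a constant $C>0$, independent of all other quantities, such that for all $p,q\in\mathbb N_0$ the following error bounds hold, where each error is the absolute difference, at $t$, of the $q$-th order local expansion obtained by the indicated chain and the $q$-th order local expansion at the same final center of $\mathcal G(s,\cdot)$. 1. Source $s$ → multipole($p$) at $c$ → local($q$) at $c'$: error $\le\frac1{4\pi}\frac C{\rho-r}\left(\frac r\rho\right)^{p+1}$, whenever $R_0>0$, $\rho>r>0$, $\|c\|=R_0+\rho$, $\|s-c\|\le r$, $\|c'\|\le R_0$, $\|c'-t\|\le R_0-\|c'\|$. 2. Source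 $s$ → local($p$) at $0$ → local($q$) at $c$: error $\le\frac1{4\pi}\frac C{\rho-r}\left(\frac r\rho\right)^{p+1}$, whenever $\rho>r>0$, $\|s\|=\rho$, $\|c\|,\|t\|\le r$, $\|t-c\|\le r-\|c\|$. 3. Source $s$ → multipole($p$) at $c$ → local($p$) at $0$ → local($q$) at $c'$: error $\le\frac C{4\pi}\left[\frac1{\rho-r}\left(\frac{R_0}{R_0+\rho-r}\right)^{p+1}+\frac1{\rho-r}\left(\frac r\rho\right)^{p+1}\right]$, in the situation of 1. *Conclusion.* There is a constant $M>0$, independent of $t_f$, $\Gamma$, $\mu$, the sources, weights, centers, targets and tree, and of the QBX and FMM orders, such that for every target $x$, with $R$ the radius $|b|$ of the smallest box $b$ in the tree, $A=\|\mu\|_\infty\sum_{i=1}^N|w_i|$ and $\omega=\min(3-\sqrt3,\;6-2\sqrt3-\sqrt3\,t_f)$, $$\left|\mathcal S_{\mathrm{QBX}(p_{\mathrm{QBX}},N)}\mu(x)-\mathcal G_{p_{\mathrm{FMM}}}[\mathcal S_{\mathrm{QBX}(p_{\mathrm{QBX}},N)}]\mu(x)\right|\le\frac{MA}{\omega R}\max\left(\frac{\sqrt3(1+t_f)}{6-\sqrt3},\frac{\sqrt3}3\right)^{p_{\mathrm{FMM}}+1}.$$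 In particular, if $t_f\le(6\sqrt3-7)/4$, the left-hand side is at most $\frac{MA}{\omega R}\left(\frac34\right)^{p_{\mathrm{FMM}}+1}$. -/

import Mathlib

namespace GigaQBX

noncomputable section

/-- Three-dimensional Euclidean space. -/
abbrev E3 := EuclideanSpace ℝ (Fin 3)

/-! Laplace kernel and spherical harmonics -/

/-- The free-space Green's function of the Laplace equation. -/
def green (x y : E3) : ℝ := (4 * Real.pi)⁻¹ * ‖x - y‖⁻¹

/-- The associated Legendre function `P_n^m` on `[-1, 1]`, by Rodrigues' formula. The phase
`(-1)^m` is immaterial: all expansions and translations below are invariant under it. -/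
def assocLegendre (n m : ℕ) (x : ℝ) : ℝ :=
  (-1) ^ m * √(1 - x ^ 2) ^ m *
    ((Polynomial.derivative^[n + m] ((Polynomial.X ^ 2 - 1 : Polynomial ℝ) ^ n)).eval x /
      (2 ^ n * (n.factorial : ℝ)))

/-- The spherical harmonic `Y_n^m(θ, φ)` of degree `n` and order `m`, `|m| ≤ n`
(it vanishes for `|m| > n`). -/
def sphY (n : ℕ) (m : ℤ) (θ φ : ℝ) : ℂ :=
  ((√((2 * n + 1) / (4 * Real.pi) *
      (((n - m.natAbs).factorial : ℝ) / ((n + m.natAbs).factorial : ℝ))) *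
    assocLegendre n m.natAbs (Real.cos θ) : ℝ) : ℂ) * Complex.exp (Complex.I * m * φ)

/-- Polar angle of a vector. -/
def polar (v : E3) : ℝ := Real.arccos (v 2 / ‖v‖)

/-- Azimuthal angle of a vector, `atan2 (v 1) (v 0)`. -/
def azimuth (v : E3) : ℝ := Complex.arg ⟨v 0, v 1⟩

/-- `Y_n^m` evaluated at the direction of a vector. -/
def Y (n : ℕ) (m : ℤ) (v : E3) : ℂ := sphY n m (polar v) (azimuth v)

/-! Local and multipole expansions -/

/-- Doubly indexed coefficients `B_n^m`, of which only those with `|m| ≤ n` are used. -/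
abbrev Coeffs := ℕ → ℤ → ℂ

/-- Sum of `f n m` over `0 ≤ n ≤ p`, `|m| ≤ n`. -/
def degSum (p : ℕ) (f : ℕ → ℤ → ℂ) : ℂ :=
  ∑ n ∈ Finset.range (p + 1), ∑ m ∈ Finset.Icc (-(n : ℤ)) n, f n m

/-- The coefficients up to degree `p`; all others are set to zero. -/
def ofOrder (p : ℕ) (f : ℕ → ℤ → ℂ) : Coeffs :=
  fun n m => if n ≤ p ∧ |m| ≤ (n : ℤ) then f n m else 0

/-- Value at `t` of the `p`-th order local expansion with coefficients `B` and center `c`. -/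
def evalLocal (p : ℕ) (B : Coeffs) (c t : E3) : ℂ :=
  degSum p fun n m => B n m * (‖t - c‖ : ℂ) ^ n * Y n m (t - c)

/-- Value at `t` of the `p`-th order multipole expansion with coefficients `B` and center `c`. -/
def evalMultipole (p : ℕ) (B : Coeffs) (c t : E3) : ℂ :=
  degSum p fun n m => B n m / (‖t - c‖ : ℂ) ^ (n + 1) * Y n (-m) (t - c)

/-- Coefficients of the `p`-th order local expansion at `c` of a unit source at `s`. -/
def sourceToLocal (p : ℕ) (s c : E3) : Coeffs :=
  ofOrder p fun n m => 1 / (2 * n + 1) * (1 / (‖s - c‖ : ℂ) ^ (n + 1)) * Y n (-m) (s - c)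

/-- Coefficients of the `p`-th order multipole expansion at `c` of a unit source at `s`. -/
def sourceToMultipole (p : ℕ) (s c : E3) : Coeffs :=
  ofOrder p fun n m => 1 / (2 * n + 1) * (‖s - c‖ : ℂ) ^ n * Y n m (s - c)

/-! Translation operators -/

/-- The normalizing constants `A_n^m = (-1)^n / √((n - m)! (n + m)!)`, `|m| ≤ n`. -/
def normA (n : ℕ) (m : ℤ) : ℂ :=
  (((-1) ^ n / √((((n : ℤ) - m).toNat.factorial : ℝ) * (((n : ℤ) + m).toNat.factorial : ℝ)) :
    ℝ) : ℂ)

/-- Regular solid harmonics `√(4π/(2n+1)) ‖v‖^n Y_n^m(v)`. -/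
def solidReg (n : ℕ) (m : ℤ) (v : E3) : ℂ :=
  (√(4 * Real.pi / (2 * n + 1)) : ℂ) * (‖v‖ : ℂ) ^ n * Y n m v

/-- Irregular solid harmonics `√(4π/(2n+1)) ‖v‖^{-(n+1)} Y_n^m(v)`. -/
def solidIrr (n : ℕ) (m : ℤ) (v : E3) : ℂ :=
  (√(4 * Real.pi / (2 * n + 1)) : ℂ) / (‖v‖ : ℂ) ^ (n + 1) * Y n m v

/-- Translation of a `p`-th order multipole expansion centered at `c` to a `q`-th order multipole
expansion centered at `c'`. -/
def multipoleToMultipole (c c' : E3) (p q : ℕ) (B : Coeffs) : Coeffs :=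
  ofOrder q fun j k => degSum p fun n m =>
    if n ≤ j then
      (√((2 * n + 1) / (2 * j + 1)) : ℂ) * Complex.I ^ (|k| - |m| - |k - m|) *
        (normA n m * normA (j - n) (k - m) / normA j k) * solidReg (j - n) (k - m) (c - c') * B n m
    else 0

/-- Translation of a `p`-th order local expansion centered at `c` to a `q`-th order local
expansion centered at `c'`. -/
def localToLocal (c c' : E3) (p q : ℕ) (B : Coeffs) : Coeffs :=
  ofOrder q fun j k => degSum p fun n m =>
    if j ≤ n then
      (√((2 * n + 1) / (2 * j + 1)) : ℂ) * Complex.I ^ (|m| - |k| - |m - k|) *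
        (normA j k * normA (n - j) (m - k) / normA n m) * solidReg (n - j) (m - k) (c' - c) * B n m
    else 0

/-- Conversion of a `p`-th order multipole expansion centered at `c` to a `q`-th order local
expansion centered at `c'`. -/
def multipoleToLocal (c c' : E3) (p q : ℕ) (B : Coeffs) : Coeffs :=
  ofOrder q fun j k => degSum p fun n m =>
    (√((2 * n + 1) / (2 * j + 1)) : ℂ) * (-1) ^ j * Complex.I ^ (|m + k| - |m| - |k|) *
      (normA n m * normA j k / normA (n + j) (m + k)) * solidIrr (n + j) (-(m + k)) (c' - c) * B n m

/-! The three hypotheses on translation errors -/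

/-- Error bound for the chain source → multipole(`p`) → local(`q`). -/
def MultipoleAccuracy : Prop :=
  ∃ C : ℝ, 0 < C ∧ ∀ (R ρ r : ℝ) (s c c' t : E3) (p q : ℕ),
    0 < R → 0 < r → r < ρ → ‖c‖ = R + ρ → ‖s - c‖ ≤ r → ‖c'‖ ≤ R → ‖c' - t‖ ≤ R - ‖c'‖ →
    ‖evalLocal q (multipoleToLocal c c' p q (sourceToMultipole p s c)) c' t -
        evalLocal q (sourceToLocal q s c') c' t‖ ≤
      1 / (4 * Real.pi) * (C / (ρ - r)) * (r / ρ) ^ (p + 1)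

/-- Error bound for the chain source → local(`p`) → local(`q`). -/
def LocalAccuracy : Prop :=
  ∃ C : ℝ, 0 < C ∧ ∀ (ρ r : ℝ) (s c t : E3) (p q : ℕ),
    0 < r → r < ρ → ‖s‖ = ρ → ‖c‖ ≤ r → ‖t‖ ≤ r → ‖t - c‖ ≤ r - ‖c‖ →
    ‖evalLocal q (localToLocal 0 c p q (sourceToLocal p s 0)) c t -
        evalLocal q (sourceToLocal q s c) c t‖ ≤
      1 / (4 * Real.pi) * (C / (ρ - r)) * (r / ρ) ^ (p + 1)

/-- Error bound for the chain source → multipole(`p`) → local(`p`) → local(`q`). -/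
def MultipoleToLocalAccuracy : Prop :=
  ∃ C : ℝ, 0 < C ∧ ∀ (R ρ r : ℝ) (s c c' t : E3) (p q : ℕ),
    0 < R → 0 < r → r < ρ → ‖c‖ = R + ρ → ‖s - c‖ ≤ r → ‖c'‖ ≤ R → ‖c' - t‖ ≤ R - ‖c'‖ →
    ‖evalLocal q (localToLocal 0 c' p q
          (multipoleToLocal c 0 p p (sourceToMultipole p s c))) c' t -
        evalLocal q (sourceToLocal q s c') c' t‖ ≤
      C / (4 * Real.pi) * (1 / (ρ - r) * (R / (R + (ρ - r))) ^ (p + 1) +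
        1 / (ρ - r) * (r / ρ) ^ (p + 1))

/-! Octrees -/

/-- A box of an octree: its level and its integer position among the `8 ^ level` boxes of
that level. -/
@[ext] structure Box where
  level : ℕ
  idx : Fin 3 → ℤ

namespace Box

/-- The root box. -/
def root : Box := ⟨0, fun _ => 0⟩

/-- The parent of a box that is not the root. -/
def parent (b : Box) : Box := ⟨b.level - 1, fun i => b.idx i / 2⟩

/-- `d` is a child of `b`. -/
def IsChild (d b : Box) : Prop := d.level = b.level + 1 ∧ ∀ i, d.idx i / 2 = b.idx i

/-- `a` is a (proper) ancestor of `d`; equivalently `d` is a descendant of `a`. -/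
def IsAncestor (a d : Box) : Prop :=
  a.level < d.level ∧ ∀ i, d.idx i / 2 ^ (d.level - a.level) = a.idx i

end Box

/-- The `ℓ^∞` distance of two points. -/
def linfDist (x y : E3) : ℝ := dist (WithLp.ofLp x) (WithLp.ofLp y)

/-- The closed cube of `ℓ^∞` radius `r` centered at `c`. -/
def cube (r : ℝ) (c : E3) : Set E3 := {x | linfDist x c ≤ r}

/-- A finite octree over an axis-aligned root cube. -/
structure Octree where
  rootCenter : E3
  rootRadius : ℝ
  rootRadius_pos : 0 < rootRadius
  boxes : Finset Box
  root_mem : Box.root ∈ boxes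
  parent_mem : ∀ b ∈ boxes, b ≠ Box.root → b.level ≠ 0 ∧ b.parent ∈ boxes

namespace Octree

variable (T : Octree)

/-- The `ℓ^∞` radius of a box. -/
def radius (b : Box) : ℝ := T.rootRadius / 2 ^ b.level

/-- The center of a box. -/
def center (b : Box) : E3 :=
  WithLp.toLp 2 fun i =>
    T.rootCenter i - T.rootRadius + (2 * (b.idx i : ℝ) + 1) * T.radius b

/-- The closed region occupied by a box. -/
def region (b : Box) : Set E3 := cube (T.radius b) (T.center b)

/-- The radius of the smallest box in the tree. -/
def minRadius : ℝ := T.boxes.inf' ⟨Box.root, T.root_mem⟩ T.radius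

/-- A leaf is a childless box. -/
def IsLeaf (b : Box) : Prop := b ∈ T.boxes ∧ ∀ d ∈ T.boxes, ¬ d.IsChild b

open Classical in
/-- The children of a box that are present in the tree. -/
def children (b : Box) : Finset Box := {d ∈ T.boxes | d.IsChild b}

/-- Two boxes are adjacent if they touch; a box touches itself and its descendants. -/
def Adjacent (a b : Box) : Prop := (T.region a ∩ T.region b).Nonempty

/-- The `k`-near neighborhood of a box. -/
def nearNeighborhood (k : ℕ) (b : Box) : Set E3 :=
  cube (T.radius b * (1 + 2 * k)) (T.center b)

/-- `d` is a `k`-colleague of `b`. -/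
def Colleague (k : ℕ) (b d : Box) : Prop :=
  d ∈ T.boxes ∧ d.level = b.level ∧ T.region d ⊆ T.nearNeighborhood k b

/-- `k`-well-separated boxes. -/
def WellSeparated (k : ℕ) (b d : Box) : Prop := d.level = b.level ∧ ¬ T.Colleague k b d

/-- The target confinement region of a box, for the target confinement factor `tf`. -/
def TCR (tf : ℝ) (b : Box) : Set E3 :=
  Metric.closedBall (T.center b) (√3 * T.radius b * (1 + tf))

/-- `a ≺ TCR(b)`: the `ℓ^2` distance from the center of `a` to `TCR(b)` is at least `3|a|`. -/
def BoxSepTCR (tf : ℝ) (a b : Box) : Prop :=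
  ∀ x ∈ T.TCR tf b, 3 * T.radius a ≤ dist (T.center a) x

/-- `TCR(a) ≺ b`: the `ℓ^∞` distance from the center of `a` to `b` is at least
`3|a|(1 + tf)`. -/
def TCRSepBox (tf : ℝ) (a b : Box) : Prop :=
  ∀ x ∈ T.region b, 3 * T.radius a * (1 + tf) ≤ linfDist (T.center a) x

end Octree

/-! Sources, expansion centers and targets -/

/-- The data of a QBX discretization with quadrature nodes on `Γ`: nodes (sources) and quadrature
weights, QBX expansion centers and radii, and targets. A target is either associated to an
expansion center whose closed expansion ball contains it, or it is a conventional target. -/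
structure QBXData (Γ : Set E3) where
  numSources : ℕ
  source : Fin numSources → Γ
  weight : Fin numSources → ℝ
  numCenters : ℕ
  center : Fin numCenters → E3
  radius : Fin numCenters → ℝ
  numTargets : ℕ
  target : Fin numTargets → E3
  assoc : Fin numTargets → Option (Fin numCenters)
  assoc_mem : ∀ τ j, assoc τ = some j → target τ ∈ Metric.closedBall (center j) (radius j)

namespace QBXData

variable {Γ : Set E3} (X : QBXData Γ)

/-- The charge `w_i μ(y_i)` at the `i`-th node. -/
def charge (μ : Γ → ℝ) (i : Fin X.numSources) : ℝ := X.weight i * μ (X.source i)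

/-- `‖μ‖_∞ ∑ |w_i|`. -/
def strength (μ : Γ → ℝ) : ℝ := (⨆ y, |μ y|) * ∑ i, |X.weight i|

/-- The unaccelerated `q`-th order QBX approximation of the single-layer potential of `μ` at a
target: plain quadrature at a conventional target, and otherwise the value of the `q`-th order
local expansion at the associated center. -/
def qbxPotential (q : ℕ) (μ : Γ → ℝ) (τ : Fin X.numTargets) : ℂ :=
  match X.assoc τ with
  | none => ∑ i, (X.charge μ i : ℂ) * (green (X.target τ) (X.source i) : ℂ)
  | some j => evalLocal q (∑ i, (X.charge μ i : ℂ) • sourceToLocal q (X.source i) (X.center j))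
      (X.center j) (X.target τ)

end QBXData

/-- An octree whose boxes own the particles. Sources and conventional targets lie in leaf boxes;
an expansion center lies in a box, not necessarily a leaf, whose target confinement region
contains the expansion ball. -/
structure FMMTree {Γ : Set E3} (X : QBXData Γ) (tf : ℝ) extends Octree where
  sourceBox : Fin X.numSources → Box
  centerBox : Fin X.numCenters → Box
  targetBox : Fin X.numTargets → Box
  source_leaf : ∀ i, toOctree.IsLeaf (sourceBox i)
  source_mem : ∀ i, (X.source i : E3) ∈ toOctree.region (sourceBox i)
  target_leaf : ∀ τ, X.assoc τ = none → toOctree.IsLeaf (targetBox τ)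
  target_mem : ∀ τ, X.assoc τ = none → X.target τ ∈ toOctree.region (targetBox τ)
  centerBox_mem : ∀ j, centerBox j ∈ boxes
  center_mem : ∀ j, X.center j ∈ toOctree.region (centerBox j)
  ball_confined : ∀ j,
    Metric.closedBall (X.center j) (X.radius j) ⊆ toOctree.TCR tf (centerBox j)

namespace FMMTree

variable {Γ : Set E3} {X : QBXData Γ} {tf : ℝ} (T : FMMTree X tf)

/-! Interaction lists -/

/-- A source box owns a source. -/
def IsSourceBox (b : Box) : Prop := ∃ i, T.sourceBox i = b

open Classical in
/-- List 1: the leaves among the box, its descendants and the boxes adjacent to it. -/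
def list1 (b : Box) : Finset Box :=
  {d ∈ T.boxes | T.IsLeaf d ∧ (b.IsAncestor d ∨ d = b ∨ T.Adjacent d b)}

open Classical in
/-- List 2: the children of the `2`-colleagues of the parent of `b` that are
`2`-well-separated from `b`. -/
def list2 (b : Box) : Finset Box :=
  {d ∈ T.boxes | b ≠ Box.root ∧ (∃ e, T.Colleague 2 b.parent e ∧ d.IsChild e) ∧
    T.WellSeparated 2 b d}

/-- `d` is a descendant of a `2`-colleague of `b`. -/
def InDescColleagues (b d : Box) : Prop :=
  d ∈ T.boxes ∧ ∃ e, T.Colleague 2 b e ∧ e.IsAncestor d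

open Classical in
/-- List 3. -/
def list3 (b : Box) : Finset Box :=
  {d ∈ T.boxes | T.InDescColleagues b d ∧ ¬ T.Adjacent d b ∧
    ∀ w, w.IsAncestor d → T.InDescColleagues b w → T.Adjacent w b}

open Classical in
/-- List 4. -/
def list4 (b : Box) : Finset Box :=
  {d ∈ T.boxes | T.IsSourceBox d ∧
    (((∃ a ∈ T.boxes, a.IsAncestor b ∧ T.Colleague 2 a d) ∧
        T.Adjacent d b.parent ∧ ¬ T.Adjacent d b) ∨
      (T.Colleague 2 b d ∧ ¬ T.Adjacent d b))}

/-- `d` is in List 3 of `b` or a descendant of a box in List 3 of `b`. -/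
def InDescList3 (b d : Box) : Prop :=
  d ∈ T.boxes ∧ ∃ e ∈ T.list3 b, d = e ∨ e.IsAncestor d

open Classical in
/-- List 3 close. -/
def list3close (b : Box) : Finset Box :=
  {d ∈ T.boxes | T.IsLeaf d ∧ T.InDescList3 b d ∧ ¬ T.BoxSepTCR tf d b}

open Classical in
/-- List 3 far. -/
def list3far (b : Box) : Finset Box :=
  {d ∈ T.boxes | T.InDescList3 b d ∧ T.BoxSepTCR tf d b ∧
    ∀ w, w.IsAncestor d → T.InDescList3 b w → ¬ T.BoxSepTCR tf w b}

open Classical in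
/-- List 4 close. -/
def list4close (b : Box) : Finset Box :=
  {d ∈ T.boxes | (∃ w ∈ T.boxes, (w.IsAncestor b ∨ w = b) ∧ d ∈ T.list4 w) ∧
    ¬ T.TCRSepBox tf b d}

open Classical in
/-- List 4 far. -/
def list4far (b : Box) : Finset Box :=
  {d ∈ T.boxes | (d ∈ T.list4 b ∨ (b ≠ Box.root ∧ d ∈ T.list4close b.parent)) ∧
    T.TCRSepBox tf b d}

/-! The algorithm, for the order `p` of the intermediate expansions and charges `g` -/

open Classical in
/-- The sources owned by a box. -/
def owned (b : Box) : Finset (Fin X.numSources) := {i | T.sourceBox i = b}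

/-- Order-`p` multipole expansion at `b` due to the sources owned by `b`. -/
def ownMultipole (p : ℕ) (g : Fin X.numSources → ℝ) (b : Box) : Coeffs :=
  ∑ i ∈ T.owned b, (g i : ℂ) • sourceToMultipole p (X.source i) (T.center b)

/-- The upward pass, through `h` generations of descendants. -/
def multipoleAux (p : ℕ) (g : Fin X.numSources → ℝ) : ℕ → Box → Coeffs
  | 0, b => T.ownMultipole p g b
  | h + 1, b => T.ownMultipole p g b + ∑ d ∈ T.children b,
      multipoleToMultipole (T.center d) (T.center b) p p (multipoleAux p g h d)

/-- The multipole expansion `M_b`; the upward pass goes through all levels of the tree. -/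
def multipole (p : ℕ) (g : Fin X.numSources → ℝ) (b : Box) : Coeffs :=
  T.multipoleAux p g (T.boxes.sup Box.level) b

/-- The contributions to the local expansion of `b` from List 2 and List 4 far of `b`. -/
def incoming (p : ℕ) (g : Fin X.numSources → ℝ) (b : Box) : Coeffs :=
  ∑ d ∈ T.list2 b, multipoleToLocal (T.center d) (T.center b) p p (T.multipole p g d) +
    ∑ d ∈ T.list4far b, ∑ i ∈ T.owned d, (g i : ℂ) • sourceToLocal p (X.source i) (T.center b)

/-- The downward pass for a box of level `k`. -/
def localAux (p : ℕ) (g : Fin X.numSources → ℝ) : ℕ → Box → Coeffs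
  | 0, b => T.incoming p g b
  | k + 1, b => T.incoming p g b +
      localToLocal (T.center b.parent) (T.center b) p p (localAux p g k b.parent)

/-- The local expansion of a box. -/
def localFar (p : ℕ) (g : Fin X.numSources → ℝ) (b : Box) : Coeffs :=
  T.localAux p g b.level b

/-- The potential at a conventional target `x` owned by `b`. -/
def pointValue (p : ℕ) (g : Fin X.numSources → ℝ) (b : Box) (x : E3) : ℂ :=
  let direct : Finset Box → ℂ := fun l =>
    ∑ d ∈ l, ∑ i ∈ T.owned d, (g i : ℂ) * (green x (X.source i) : ℂ)
  (direct (T.list1 b) + direct (T.list3close b) + direct (T.list4close b)) +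
    ∑ d ∈ T.list3far b, evalMultipole p (T.multipole p g d) (T.center d) x +
    evalLocal p (T.localFar p g b) (T.center b) x

/-- The coefficients of the `q`-th order QBX local expansion at a center `c` owned by `b`. -/
def qbxCoeffs (p q : ℕ) (g : Fin X.numSources → ℝ) (b : Box) (c : E3) : Coeffs :=
  let direct : Finset Box → Coeffs := fun l =>
    ∑ d ∈ l, ∑ i ∈ T.owned d, (g i : ℂ) • sourceToLocal q (X.source i) c
  (direct (T.list1 b) + direct (T.list3close b) + direct (T.list4close b)) +
    ∑ d ∈ T.list3far b, multipoleToLocal (T.center d) c p q (T.multipole p g d) +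
    localToLocal (T.center b) c p q (T.localFar p g b)

/-- The output at a target of the GIGAQBX FMM of order `p` applied to the `q`-th order QBX
approximation of the single-layer potential of `μ`. -/
def fmmPotential (p q : ℕ) (μ : Γ → ℝ) (τ : Fin X.numTargets) : ℂ :=
  match X.assoc τ with
  | none => T.pointValue p (X.charge μ) (T.targetBox τ) (X.target τ)
  | some j => evalLocal q (T.qbxCoeffs p q (X.charge μ) (T.centerBox j) (X.center j))
      (X.center j) (X.target τ)

end FMMTree

end

end GigaQBX

/-!
The proof compares the algorithm with direct summation one source at a time. All steps of the
algorithm are linear, so its result at a target is a sum over the sources, and it suffices to bound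
the error for a unit source at `y` owned by a leaf `s`.

*Translations of like type are exact.* The coefficient of `T^(n+m)` in
`(-1)^n / n! · ((i/2) w T² + z T + (i/2) w̄)^n`, where `w = v 0 + i v 1` and `z = v 2`, is a multiple
of the solid harmonic `‖v‖^n Y_n^m(v)` (`harm_eq_solidReg`); this is Rodrigues' formula, read through
Taylor expansion. As the trinomial is linear in `v`, the addition theorem for solid harmonics is the
binomial theorem (`harm_add`). Hence multipole-to-multipole translation reproduces the truncated
multipole expansion of a source exactly (`multipoleToMultipole_sourceToMultipole`), and
local-to-local translations compose exactly (`localToLocal_localToLocal`). So every contribution that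
arrives at a QBX center `c` is either a direct one, without error, or one of the three chains of
translations in the hypotheses.

*Every source is accounted for exactly once* (`interaction_count`). Follow the ancestors of the
target box `b` and of `s` from the root down. If they cease to be `2`-colleagues at some level, then
the interaction takes place in List 2 at that level. Otherwise either `s` touches `b` (List 1), or
`s` is finer than `b` and at some level its ancestors leave the neighborhood of `b` (List 3), or `s`
is not finer and at some level the ancestors of `b` cease to touch `s` (List 4). From then on the
interaction is close until it becomes far. All these conditions persist once they hold, so the
uniqueness is in each case the fact that a persistent property becomes true at one level only
(`sum_first_time`).

*Each far interaction converges at the required rate.* The target confinement region of `b` lies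
within those of its ancestors (`Confined.up`), so the hypotheses apply about the centers of the boxes
in which the interaction takes place. List 3 far and List 4 far give the ratio `√3 / 3`
(`list3far_ratio`, `list4far_ratio`). A List 2 interaction gives the two ratios
`√3 (1 + tf) / (6 - √3)` and `√3 / (6 - √3 (1 + tf))`, of which the first is the larger one
(`list2_ratio`, `second_ratio_le`).

Finally, a conventional target `x` needs no separate analysis: evaluating an expansion at `x` is the
same as translating it to a local expansion of order zero centered at `x` (`pointValue_eq`).
-/

namespace GigaQBX

/-! ### Powers of a quadratic trinomial and Legendre functions -/

open Polynomial in
/-- Scaling the variable: the upper half of the coefficients of `(aX² + bX + c)^n` depends, up to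
a power of `a`, only on `b` and on the product `ac`. -/
theorem coeff_trinomial_pow {K : Type*} [Field K] (a b c : K) (n m : ℕ) :
    ((C a * X ^ 2 + C b * X + C c) ^ n : K[X]).coeff (n + m) =
      a ^ m * ((X ^ 2 + C b * X + C (a * c)) ^ n : K[X]).coeff (n + m) := by
  rcases eq_or_ne a 0 with rfl | ha
  · rcases m.eq_zero_or_pos with rfl | hm
    · have h1 : ((C 0 * X ^ 2 + C b * X + C c) ^ n : K[X]).coeff (n + 0) = b ^ n := by
        have := coeff_pow_of_natDegree_le (p := (C b * X + C c : K[X])) (m := n) (n := 1)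
          natDegree_linear_le
        simpa using this
      have h2 : (X ^ 2 + C b * X + C (0 * c) : K[X]) = X * (X + C b) := by
        simp; ring
      rw [h1, h2, mul_pow, add_zero, coeff_X_pow_mul' , if_pos le_rfl]
      simp [coeff_zero_eq_eval_zero]
    · rw [zero_pow hm.ne', zero_mul]
      apply coeff_eq_zero_of_natDegree_lt
      have h : natDegree (C 0 * X ^ 2 + C b * X + C c : K[X]) ≤ 1 := by
        simpa using natDegree_linear_le (a := b) (b := c)
      have := natDegree_pow_le_of_le n h
      omega
  · have h : ((X ^ 2 + C b * X + C (a * c) : K[X]) ^ n).comp (C a * X) =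
        C (a ^ n) * (C a * X ^ 2 + C b * X + C c) ^ n := by
      rw [pow_comp, C_pow, ← mul_pow]
      congr 1
      simp only [add_comp, mul_comp, pow_comp, X_comp, C_comp, C_mul]
      ring
    have h' := congrArg (fun p => coeff p (n + m)) h
    simp only [comp_C_mul_X_coeff, coeff_C_mul] at h'
    apply mul_left_cancel₀ (pow_ne_zero n ha)
    rw [← h', pow_add]; ring

open Polynomial in
/-- Reversing the coefficients of the power of a quadratic trinomial. -/
theorem coeff_trinomial_pow_symm {R : Type*} [CommRing R] (a b c : R) {n i j : ℕ}
    (h : i + j = 2 * n) :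
    ((C a * X ^ 2 + C b * X + C c) ^ n : R[X]).coeff i =
      ((C c * X ^ 2 + C b * X + C a) ^ n : R[X]).coeff j := by
  have hd : ∀ a b c : R, natDegree (C a * X ^ 2 + C b * X + C c : R[X]) ≤ 2 :=
    fun a b c => natDegree_quadratic_le
  have hr : reflect 2 (C a * X ^ 2 + C b * X + C c : R[X]) = C c * X ^ 2 + C b * X + C a := by
    ext k
    rw [coeff_reflect]
    rcases Nat.lt_or_ge 2 k with hk | hk
    · rw [revAt_eq_self_of_lt hk, coeff_eq_zero_of_natDegree_lt ((hd _ _ _).trans_lt hk),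
        coeff_eq_zero_of_natDegree_lt ((hd _ _ _).trans_lt hk)]
    · rw [revAt_le hk]
      interval_cases k <;> simp [coeff_X, coeff_C, coeff_X_pow]
  have key : ∀ n : ℕ, reflect (2 * n) ((C a * X ^ 2 + C b * X + C c) ^ n : R[X]) =
      (C c * X ^ 2 + C b * X + C a) ^ n := by
    intro n
    induction n with
    | zero => simp
    | succ n ih =>
      have hn := natDegree_pow_le_of_le n (hd a b c)
      rw [pow_succ, mul_add, mul_one, reflect_mul _ _ (hn.trans (by omega)) (hd _ _ _), ih, hr,
        ← pow_succ]
  rw [← key, coeff_reflect, revAt_le (by omega)]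
  congr 1
  omega

open Polynomial in
/-- The derivatives in Rodrigues' formula are coefficients of powers of a quadratic trinomial,
by Taylor expansion. -/
theorem iterate_derivative_eval_eq_coeff (n k : ℕ) (x : ℝ) :
    (derivative^[k] ((X ^ 2 - 1 : ℝ[X]) ^ n)).eval x =
      k.factorial * ((X ^ 2 + C (2 * x) * X + C (x ^ 2 - 1)) ^ n : ℝ[X]).coeff k := by
  have h : taylor x ((X ^ 2 - 1 : ℝ[X]) ^ n) = (X ^ 2 + C (2 * x) * X + C (x ^ 2 - 1)) ^ n := by
    rw [taylor_pow]
    congr 1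
    simp only [taylor_apply, sub_comp, pow_comp, X_comp, one_comp, C_sub, C_mul, C_pow, map_ofNat,
      C_1]
    ring
  rw [← h, taylor_coeff, ← factorial_smul_hasseDeriv]
  simp

open Polynomial in
/-- Rodrigues' formula in algebraic form: the associated Legendre functions are, up to factors,
the coefficients of the powers of `(i s e / 2) X² + x X + (i s / (2 e))`, where `s = √(1 - x²)`. -/
theorem coeff_pow_eq_assocLegendre (n m : ℕ) (x : ℝ) (hx : x ^ 2 ≤ 1) (e : ℂ) (he : e ≠ 0) :
    ((C (Complex.I / 2 * √(1 - x ^ 2) * e) * X ^ 2 + C (x : ℂ) * X +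
        C (Complex.I / 2 * √(1 - x ^ 2) * e⁻¹)) ^ n : ℂ[X]).coeff (n + m) =
      (-Complex.I * e) ^ m * n.factorial / (n + m).factorial * assocLegendre n m x := by
  have hs : ((√(1 - x ^ 2) : ℝ) : ℂ) ^ 2 = 1 - (x : ℂ) ^ 2 := by
    rw [← Complex.ofReal_pow, Real.sq_sqrt (by linarith)]; push_cast; ring
  set s : ℂ := ((√(1 - x ^ 2) : ℝ) : ℂ) with hsdef
  have hac : Complex.I / 2 * s * e * (Complex.I / 2 * s * e⁻¹) = ((x : ℂ) ^ 2 - 1) / 4 := by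
    have : Complex.I / 2 * s * e * (Complex.I / 2 * s * e⁻¹) =
      Complex.I ^ 2 * s ^ 2 / 4 * (e * e⁻¹) := by ring
    rw [this, mul_inv_cancel₀ he, hs, Complex.I_sq]; ring
  rw [coeff_trinomial_pow, hac]
  -- rescaling `X` by `2` turns `X² + xX + (x² - 1)/4` into a quarter of `X² + 2xX + (x² - 1)`
  -- evaluated at `2X`
  have hscale : ((X ^ 2 + C (2 * (x : ℂ)) * X + C ((x : ℂ) ^ 2 - 1)) ^ n : ℂ[X]).comp (C 2 * X) =
      C (4 ^ n) * (X ^ 2 + C (x : ℂ) * X + C (((x : ℂ) ^ 2 - 1) / 4)) ^ n := by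
    rw [pow_comp, C_pow, ← mul_pow]
    congr 1
    simp only [add_comp, mul_comp, pow_comp, X_comp, C_comp]
    rw [mul_add, mul_add, ← C_mul, mul_div_cancel₀ _ (by norm_num : (4 : ℂ) ≠ 0)]
    have h4 : (C (4 : ℂ)) = C 2 * C 2 := by rw [← C_mul]; norm_num
    rw [h4, C_mul]; ring
  have hc := congrArg (fun p => coeff p (n + m)) hscale
  simp only [comp_C_mul_X_coeff, coeff_C_mul] at hc
  have hreal : ((X ^ 2 + C (2 * (x : ℂ)) * X + C ((x : ℂ) ^ 2 - 1)) ^ n : ℂ[X]).coeff (n + m) =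
      ((((X ^ 2 + C (2 * x) * X + C (x ^ 2 - 1)) ^ n : ℝ[X]).coeff (n + m) : ℝ) : ℂ) := by
    have hmap : ((X ^ 2 + C (2 * (x : ℂ)) * X + C ((x : ℂ) ^ 2 - 1)) ^ n : ℂ[X]) =
        ((X ^ 2 + C (2 * x) * X + C (x ^ 2 - 1)) ^ n : ℝ[X]).map Complex.ofRealHom := by
      simp [Polynomial.map_pow]
    rw [hmap, coeff_map]; rfl
  have hcoef : ((X ^ 2 + C (x : ℂ) * X + C (((x : ℂ) ^ 2 - 1) / 4)) ^ n : ℂ[X]).coeff (n + m) =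
      ((((X ^ 2 + C (2 * x) * X + C (x ^ 2 - 1)) ^ n : ℝ[X]).coeff (n + m) : ℝ) : ℂ) *
        2 ^ m / 2 ^ n := by
    rw [← hreal, eq_div_iff (pow_ne_zero n two_ne_zero)]
    have h4 : (4 : ℂ) ^ n = 2 ^ n * 2 ^ n := by rw [← mul_pow]; norm_num
    rw [h4, pow_add] at hc
    apply mul_left_cancel₀ (pow_ne_zero n (two_ne_zero' ℂ))
    linear_combination -hc
  rw [hcoef, assocLegendre, iterate_derivative_eval_eq_coeff]
  have hf1 : (n.factorial : ℂ) ≠ 0 := by exact_mod_cast n.factorial_ne_zero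
  have hf2 : ((n + m).factorial : ℂ) ≠ 0 := by exact_mod_cast (n + m).factorial_ne_zero
  generalize ((X ^ 2 + C (2 * x) * X + C (x ^ 2 - 1)) ^ n : ℝ[X]).coeff (n + m) = d
  push_cast
  rw [← hsdef]
  have h1 : (Complex.I / 2 * s * e) ^ m * 2 ^ m = (Complex.I * e) ^ m * s ^ m := by
    rw [← mul_pow, ← mul_pow]; congr 1; ring
  have h2 : (-Complex.I * e) ^ m * (-1) ^ m = (Complex.I * e) ^ m := by
    rw [← mul_pow]; congr 1; ring
  have h3 : (-Complex.I * e) ^ m * n.factorial / (n + m).factorial *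
      ((-1) ^ m * s ^ m * ((n + m).factorial * d / (2 ^ n * n.factorial))) =
      (-Complex.I * e) ^ m * (-1) ^ m * s ^ m * (d / 2 ^ n) := by
    field_simp
  rw [h3, h2, ← h1]
  ring

/-! ### The addition theorem for regular solid harmonics -/

open Polynomial in
/-- The quadratic trinomial `T(z + (i/2)(w T + w̄ T⁻¹))`, `w = v 0 + i v 1`, `z = v 2`, attached to
a point of space. It is linear in the point, and the coefficients of its powers are the solid
harmonics. -/
noncomputable def harmPoly (v : E3) : ℂ[X] :=
  C (Complex.I / 2 * (v 0 + v 1 * Complex.I)) * X ^ 2 + C (v 2 : ℂ) * X +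
    C (Complex.I / 2 * (v 0 - v 1 * Complex.I))

/-- The regular solid harmonics, normalized so that their addition theorem is a convolution. The
index `m` is arbitrary; the value is `0` for `|m| > n`. -/
noncomputable def harm (n : ℕ) (m : ℤ) (v : E3) : ℂ :=
  if -(n : ℤ) ≤ m then (-1) ^ n / n.factorial * ((harmPoly v) ^ n).coeff (n + m).toNat else 0

theorem norm_mul_cos_polar (v : E3) : ‖v‖ * Real.cos (polar v) = v 2 := by
  rcases eq_or_ne v 0 with rfl | hv
  · simp
  have hp : 0 < ‖v‖ := norm_pos_iff.mpr hv
  have h : |v 2| ≤ ‖v‖ := PiLp.norm_apply_le v 2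
  have h' := abs_le.mp h
  rw [polar, Real.cos_arccos, mul_div_cancel₀ _ hp.ne']
  · rw [le_div_iff₀ hp]; linarith
  · rw [div_le_one hp]; linarith

theorem norm_sq_eq (v : E3) : ‖v‖ ^ 2 = v 0 ^ 2 + v 1 ^ 2 + v 2 ^ 2 := by
  rw [EuclideanSpace.real_norm_sq_eq, Fin.sum_univ_three]

theorem norm_mul_sin_mul_exp (v : E3) :
    (‖v‖ : ℂ) * (√(1 - Real.cos (polar v) ^ 2) : ℝ) * Complex.exp (Complex.I * azimuth v) =
      v 0 + v 1 * Complex.I := by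
  have h : ‖v‖ * √(1 - Real.cos (polar v) ^ 2) = ‖(⟨v 0, v 1⟩ : ℂ)‖ := by
    rw [← Real.sqrt_sq (norm_nonneg v), ← Real.sqrt_mul (sq_nonneg _), mul_sub, ← mul_pow,
      norm_mul_cos_polar, norm_sq_eq, Complex.norm_def, Complex.normSq_mk]
    congr 1
    ring
  rw [← Complex.ofReal_mul, h, azimuth, mul_comm Complex.I, Complex.norm_mul_exp_arg_mul_I]
  apply Complex.ext <;> simp

theorem norm_mul_sin_mul_exp_inv (v : E3) :
    (‖v‖ : ℂ) * (√(1 - Real.cos (polar v) ^ 2) : ℝ) * (Complex.exp (Complex.I * azimuth v))⁻¹ =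
      v 0 - v 1 * Complex.I := by
  have h := congrArg (starRingEnd ℂ) (norm_mul_sin_mul_exp v)
  simp only [map_mul, map_add, Complex.conj_ofReal, ← Complex.exp_conj, Complex.conj_I] at h
  rw [← Complex.exp_neg, ← neg_mul, h]
  ring

open Polynomial in
theorem harmPoly_eq (v : E3) :
    harmPoly v = C (‖v‖ : ℂ) *
      (C (Complex.I / 2 * (√(1 - Real.cos (polar v) ^ 2) : ℝ) *
          Complex.exp (Complex.I * azimuth v)) * X ^ 2 +
        C ((Real.cos (polar v) : ℝ) : ℂ) * X +
        C (Complex.I / 2 * (√(1 - Real.cos (polar v) ^ 2) : ℝ) *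
          (Complex.exp (Complex.I * azimuth v))⁻¹)) := by
  rw [harmPoly, ← norm_mul_sin_mul_exp, ← norm_mul_sin_mul_exp_inv, ← norm_mul_cos_polar]
  simp only [mul_add, ← mul_assoc, ← C_mul, Complex.ofReal_mul]
  congr 4
  · ring
  · ring

theorem harmPoly_natDegree_pow_le (v : E3) (n : ℕ) : ((harmPoly v) ^ n).natDegree ≤ 2 * n :=
  (Polynomial.natDegree_pow_le_of_le n Polynomial.natDegree_quadratic_le).trans (by omega)

theorem harm_eq_zero {n : ℕ} {m : ℤ} (h : (n : ℤ) < |m|) (v : E3) : harm n m v = 0 := by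
  unfold harm
  split_ifs with hm
  · rw [Polynomial.coeff_eq_zero_of_natDegree_lt, mul_zero]
    have := harmPoly_natDegree_pow_le v n
    rcases abs_cases m with h' | h' <;> omega
  · rfl

theorem sphY_eq_zero {n : ℕ} {m : ℤ} (h : (n : ℤ) < |m|) (θ φ : ℝ) : sphY n m θ φ = 0 := by
  have h1 : n < m.natAbs := by rw [Int.abs_eq_natAbs] at h; omega
  have h2 : assocLegendre n m.natAbs (Real.cos θ) = 0 := by
    rw [assocLegendre, Polynomial.iterate_derivative_eq_zero]
    · simp
    · have : ((Polynomial.X ^ 2 - 1 : Polynomial ℝ)).natDegree ≤ 2 := by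
        compute_degree
      have := Polynomial.natDegree_pow_le_of_le n this
      omega
  simp [sphY, h2]

theorem solidReg_eq_zero {n : ℕ} {m : ℤ} (h : (n : ℤ) < |m|) (v : E3) : solidReg n m v = 0 := by
  simp [solidReg, Y, sphY_eq_zero h]

theorem normA_mul_sqrt (n : ℕ) (m : ℤ) :
    (-1) ^ n / √((((n : ℤ) - m).toNat.factorial : ℝ) * (((n : ℤ) + m).toNat.factorial : ℝ)) *
      (√(4 * Real.pi / (2 * n + 1)) * √((2 * n + 1) / (4 * Real.pi) *
      (((n - m.natAbs).factorial : ℝ) / ((n + m.natAbs).factorial : ℝ)))) =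
      (-1) ^ n / (n + m.natAbs).factorial := by
  have h1 : (((n : ℤ) - m).toNat.factorial : ℝ) * (((n : ℤ) + m).toNat.factorial : ℝ) =
      (n - m.natAbs).factorial * (n + m.natAbs).factorial := by
    rcases le_total 0 m with hm | hm
    · rw [show ((n : ℤ) - m).toNat = n - m.natAbs by omega,
        show ((n : ℤ) + m).toNat = n + m.natAbs by omega]
    · rw [show ((n : ℤ) - m).toNat = n + m.natAbs by omega,
        show ((n : ℤ) + m).toNat = n - m.natAbs by omega, mul_comm]
  rw [h1]
  have ha : (0 : ℝ) < (n - m.natAbs).factorial := by exact_mod_cast Nat.factorial_pos _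
  have hb : (0 : ℝ) < (n + m.natAbs).factorial := by exact_mod_cast Nat.factorial_pos _
  generalize ((n - m.natAbs).factorial : ℝ) = a at *
  generalize ((n + m.natAbs).factorial : ℝ) = b at *
  have hpi := Real.pi_pos
  rw [← Real.sqrt_mul (by positivity),
    show 4 * Real.pi / (2 * n + 1) * ((2 * n + 1) / (4 * Real.pi) * (a / b)) = (a * b) / b ^ 2 by
      field_simp, Real.sqrt_div (by positivity), Real.sqrt_sq hb.le]
  have : √(a * b) ≠ 0 := by positivity
  field_simp

theorem normA_ne_zero (n : ℕ) (m : ℤ) : normA n m ≠ 0 := by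
  rw [normA, Ne, Complex.ofReal_eq_zero]
  have h1 : (0 : ℝ) < ((n : ℤ) - m).toNat.factorial := by exact_mod_cast Nat.factorial_pos _
  have h2 : (0 : ℝ) < ((n : ℤ) + m).toNat.factorial := by exact_mod_cast Nat.factorial_pos _
  have : √((((n : ℤ) - m).toNat.factorial : ℝ) * (((n : ℤ) + m).toNat.factorial : ℝ)) ≠ 0 := by
    positivity
  exact div_ne_zero (pow_ne_zero _ (by norm_num)) this

open Polynomial in
theorem coeff_harmPoly_pow (n : ℕ) {m : ℤ} (h : |m| ≤ n) (v : E3) :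
    ((harmPoly v) ^ n).coeff (n + m).toNat =
      (‖v‖ : ℂ) ^ n * ((-Complex.I) ^ m.natAbs * n.factorial / (n + m.natAbs).factorial *
        assocLegendre n m.natAbs (Real.cos (polar v)) *
        Complex.exp (Complex.I * m * azimuth v)) := by
  have hx : Real.cos (polar v) ^ 2 ≤ 1 := Real.cos_sq_le_one _
  have he := Complex.exp_ne_zero (Complex.I * azimuth v)
  rw [harmPoly_eq, mul_pow, ← C_pow, coeff_C_mul]
  congr 1
  rcases le_total 0 m with hm | hm
  · rw [show ((n : ℤ) + m).toNat = n + m.natAbs by omega,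
      coeff_pow_eq_assocLegendre n m.natAbs _ hx _ he, mul_pow, ← Complex.exp_nat_mul]
    have : ((m.natAbs : ℕ) : ℂ) * (Complex.I * azimuth v) = Complex.I * m * azimuth v := by
      have h' : ((m.natAbs : ℕ) : ℂ) = m := by
        rw [Nat.cast_natAbs, abs_of_nonneg hm]
      rw [h']; ring
    rw [this]; ring
  · rw [Int.abs_eq_natAbs] at h
    rw [coeff_trinomial_pow_symm (i := ((n : ℤ) + m).toNat) (j := n + m.natAbs) _ _ _ (by omega)]
    have := coeff_pow_eq_assocLegendre n m.natAbs _ hx _ (inv_ne_zero he)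
    rw [inv_inv] at this
    rw [this, mul_pow, ← Complex.exp_neg, ← Complex.exp_nat_mul]
    have : ((m.natAbs : ℕ) : ℂ) * -(Complex.I * azimuth v) = Complex.I * m * azimuth v := by
      have h' : ((m.natAbs : ℕ) : ℂ) = -m := by
        rw [Nat.cast_natAbs, abs_of_nonpos hm, Int.cast_neg]
      rw [h']; ring
    rw [this]; ring

/-- The normalized harmonics are the classical ones, with the factors that occur in the
translation operators. -/
theorem harm_eq_solidReg (n : ℕ) (m : ℤ) (v : E3) :
    harm n m v = Complex.I ^ (-|m|) * normA n m * solidReg n m v := by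
  rcases lt_or_ge (n : ℤ) |m| with h | h
  · rw [harm_eq_zero h, solidReg_eq_zero h, mul_zero]
  have hm : -(n : ℤ) ≤ m := by linarith [neg_abs_le m]
  have hI : Complex.I ^ (-|m|) = (-Complex.I) ^ m.natAbs := by
    rw [zpow_neg, Int.abs_eq_natAbs, zpow_natCast, ← inv_pow, Complex.inv_I]
  rw [harm, if_pos hm, coeff_harmPoly_pow n h, solidReg, Y, sphY, hI, normA]
  have key := congrArg (fun x : ℝ => (x : ℂ)) (normA_mul_sqrt n m)
  have hf : (n.factorial : ℂ) ≠ 0 := by exact_mod_cast n.factorial_ne_zero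
  have hf2 : ((n + m.natAbs).factorial : ℂ) ≠ 0 := by exact_mod_cast Nat.factorial_ne_zero _
  simp only [Complex.ofReal_mul] at key ⊢
  rw [Complex.ofReal_div ((-1) ^ n) ((n + m.natAbs).factorial : ℝ), Complex.ofReal_natCast] at key
  calc _ = (((-1 : ℝ) ^ n : ℝ) : ℂ) / ((n + m.natAbs).factorial : ℂ) *
        ((-Complex.I) ^ m.natAbs * (‖v‖ : ℂ) ^ n *
          assocLegendre n m.natAbs (Real.cos (polar v)) *
          Complex.exp (Complex.I * m * azimuth v)) := by
        push_cast; field_simp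
    _ = _ := by rw [← key]; ring

theorem harmPoly_add (u v : E3) : harmPoly (u + v) = harmPoly u + harmPoly v := by
  simp only [harmPoly, PiLp.add_apply, Complex.ofReal_add, mul_add, add_mul, mul_sub,
    Polynomial.C_add, Polynomial.C_sub]
  ring

/-- A coefficient of a product of polynomials of bounded degree as a sum over a range of integers
centered at zero. -/
theorem coeff_mul_pow_harmPoly (n l : ℕ) (k : ℤ) (hk : |k| ≤ (n + l : ℕ)) (u v : E3) :
    ((harmPoly u) ^ n * (harmPoly v) ^ l).coeff ((n + l : ℕ) + k).toNat =
      ∑ m ∈ Finset.Icc (-(n : ℤ)) n, ((harmPoly u) ^ n).coeff (n + m).toNat *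
        if -(l : ℤ) ≤ k - m then ((harmPoly v) ^ l).coeff (l + (k - m)).toNat else 0 := by
  have hk' := abs_le.mp hk
  rw [Polynomial.coeff_mul, Finset.Nat.sum_antidiagonal_eq_sum_range_succ
    (fun i j => ((harmPoly u) ^ n).coeff i * ((harmPoly v) ^ l).coeff j)]
  symm
  refine Finset.sum_bij_ne_zero (fun m _ _ => (n + m).toNat) ?_ ?_ ?_ ?_
  · intro m hm h0
    rw [Finset.mem_Icc] at hm
    have : -(l : ℤ) ≤ k - m := by
      by_contra hc; simp [hc] at h0
    rw [Finset.mem_range]; omega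
  · intro a ha _ b hb _ hab
    rw [Finset.mem_Icc] at ha hb
    omega
  · intro i hi h0
    rw [Finset.mem_range] at hi
    have hin : i ≤ 2 * n := by
      by_contra hc
      rw [Polynomial.coeff_eq_zero_of_natDegree_lt
        ((harmPoly_natDegree_pow_le u n).trans_lt (by omega)), zero_mul] at h0
      exact h0 rfl
    refine ⟨i - n, Finset.mem_Icc.mpr (by omega), ?_, by omega⟩
    rw [if_pos (by omega), show ((n : ℤ) + (i - n)).toNat = i by omega,
      show ((l : ℤ) + (k - (i - n))).toNat = ((n + l : ℕ) + k).toNat - i by omega]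
    exact h0
  · intro m hm h0
    rw [Finset.mem_Icc] at hm
    have h1 : -(l : ℤ) ≤ k - m := by
      by_contra hc; simp [hc] at h0
    rw [if_pos h1]
    congr 2
    omega

/-- The addition theorem for regular solid harmonics. It is the binomial theorem for
`harmPoly u + harmPoly v`. -/
theorem harm_add (j : ℕ) (k : ℤ) (u v : E3) :
    harm j k (u + v) = ∑ n ∈ Finset.range (j + 1), ∑ m ∈ Finset.Icc (-(n : ℤ)) n,
      harm n m u * harm (j - n) (k - m) v := by
  rcases lt_or_ge (j : ℤ) |k| with h | h
  · rw [harm_eq_zero h]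
    symm
    refine Finset.sum_eq_zero fun n hn => Finset.sum_eq_zero fun m hm => ?_
    rw [Finset.mem_range] at hn
    rw [Finset.mem_Icc] at hm
    rw [harm_eq_zero (n := j - n), mul_zero]
    have h1 : |m| ≤ n := abs_le.mpr hm
    have h2 := abs_sub_abs_le_abs_sub k m
    omega
  have hk := abs_le.mp h
  rw [harm, if_pos hk.1, harmPoly_add, add_pow, Polynomial.finsetSum_coeff, Finset.mul_sum]
  refine Finset.sum_congr rfl fun n hn => ?_
  rw [Finset.mem_range] at hn
  obtain ⟨l, rfl⟩ : ∃ l, j = n + l := ⟨j - n, by omega⟩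
  rw [Nat.add_sub_cancel_left, ← Polynomial.C_eq_natCast, Polynomial.coeff_mul_C,
    coeff_mul_pow_harmPoly n l k h, Finset.sum_mul, Finset.mul_sum]
  refine Finset.sum_congr rfl fun m hm => ?_
  rw [Finset.mem_Icc] at hm
  rw [harm, if_pos hm.1, harm]
  have hc : ((n + l).choose n : ℂ) / (n + l).factorial = 1 / n.factorial * (1 / l.factorial) := by
    have := Nat.choose_mul_factorial_mul_factorial (Nat.le_add_right n l)
    rw [Nat.add_sub_cancel_left] at this
    have h1 : (n.factorial : ℂ) ≠ 0 := by exact_mod_cast n.factorial_ne_zero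
    have h2 : (l.factorial : ℂ) ≠ 0 := by exact_mod_cast l.factorial_ne_zero
    have h3 : ((n + l).factorial : ℂ) ≠ 0 := by exact_mod_cast (n + l).factorial_ne_zero
    field_simp
    exact_mod_cast this
  split_ifs
  · rw [pow_add]
    generalize ((harmPoly u) ^ n).coeff _ = a
    generalize ((harmPoly v) ^ l).coeff _ = b
    linear_combination (-1) ^ n * (-1) ^ l * a * b * hc
  · simp

noncomputable section

/-! ### Sums over degrees and orders -/

theorem degSum_add (p : ℕ) (f g : ℕ → ℤ → ℂ) :
    degSum p (fun n m => f n m + g n m) = degSum p f + degSum p g := by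
  simp only [degSum, Finset.sum_add_distrib]

theorem mul_degSum (p : ℕ) (a : ℂ) (f : ℕ → ℤ → ℂ) :
    a * degSum p f = degSum p (fun n m => a * f n m) := by
  simp only [degSum, Finset.mul_sum]

theorem degSum_congr {p : ℕ} {f g : ℕ → ℤ → ℂ}
    (h : ∀ n ≤ p, ∀ m : ℤ, |m| ≤ n → f n m = g n m) : degSum p f = degSum p g := by
  refine Finset.sum_congr rfl fun n hn => Finset.sum_congr rfl fun m hm => ?_
  rw [Finset.mem_range] at hn
  rw [Finset.mem_Icc] at hm
  exact h n (by omega) m (abs_le.mpr hm)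

theorem degSum_comm (p : ℕ) (f : ℕ → ℤ → ℕ → ℤ → ℂ) :
    degSum p (fun n m => degSum p (f n m)) =
      degSum p (fun n' m' => degSum p fun n m => f n m n' m') := by
  have h : ∀ g : ℕ → ℤ → ℂ, degSum p g =
      ∑ x ∈ (Finset.range (p + 1)).sigma (fun n => Finset.Icc (-(n : ℤ)) n), g x.1 x.2 := by
    intro g
    rw [Finset.sum_sigma]
    rfl
  simp only [h]
  exact Finset.sum_comm

theorem ofOrder_add (p : ℕ) (f g : ℕ → ℤ → ℂ) :
    ofOrder p (fun n m => f n m + g n m) = ofOrder p f + ofOrder p g := by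
  funext n m
  simp only [ofOrder, Pi.add_apply]
  split_ifs <;> simp

theorem ofOrder_mul (p : ℕ) (a : ℂ) (f : ℕ → ℤ → ℂ) :
    ofOrder p (fun n m => a * f n m) = a • ofOrder p f := by
  funext n m
  simp only [ofOrder, Pi.smul_apply, smul_eq_mul, mul_ite, mul_zero]

/-! ### Linearity of evaluation and translation -/

/-- `evalLocal` as a linear map. -/
def evalLocalLin (p : ℕ) (c t : E3) : Coeffs →ₗ[ℂ] ℂ where
  toFun B := evalLocal p B c t
  map_add' B B' := by
    simp only [evalLocal, ← degSum_add, Pi.add_apply, add_mul]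
  map_smul' a B := by
    simp only [evalLocal, smul_eq_mul, mul_degSum, Pi.smul_apply, RingHom.id_apply, mul_assoc]

/-- `multipoleToMultipole` as a linear map. -/
def multipoleToMultipoleLin (c c' : E3) (p q : ℕ) : Coeffs →ₗ[ℂ] Coeffs where
  toFun B := multipoleToMultipole c c' p q B
  map_add' B B' := by
    simp only [multipoleToMultipole, ← ofOrder_add, ← degSum_add]
    refine congrArg _ (funext fun j => funext fun k => congrArg _ (funext fun n =>
      funext fun m => ?_))
    split_ifs
    · simp only [Pi.add_apply]; ring
    · simp
  map_smul' a B := by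
    simp only [multipoleToMultipole, RingHom.id_apply, ← ofOrder_mul, mul_degSum]
    refine congrArg _ (funext fun j => funext fun k => congrArg _ (funext fun n =>
      funext fun m => ?_))
    split_ifs
    · simp only [Pi.smul_apply, smul_eq_mul]; ring
    · simp

/-- `localToLocal` as a linear map. -/
def localToLocalLin (c c' : E3) (p q : ℕ) : Coeffs →ₗ[ℂ] Coeffs where
  toFun B := localToLocal c c' p q B
  map_add' B B' := by
    simp only [localToLocal, ← ofOrder_add, ← degSum_add]
    refine congrArg _ (funext fun j => funext fun k => congrArg _ (funext fun n =>
      funext fun m => ?_))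
    split_ifs
    · simp only [Pi.add_apply]; ring
    · simp
  map_smul' a B := by
    simp only [localToLocal, RingHom.id_apply, ← ofOrder_mul, mul_degSum]
    refine congrArg _ (funext fun j => funext fun k => congrArg _ (funext fun n =>
      funext fun m => ?_))
    split_ifs
    · simp only [Pi.smul_apply, smul_eq_mul]; ring
    · simp

/-- `multipoleToLocal` as a linear map. -/
def multipoleToLocalLin (c c' : E3) (p q : ℕ) : Coeffs →ₗ[ℂ] Coeffs where
  toFun B := multipoleToLocal c c' p q B
  map_add' B B' := by
    simp only [multipoleToLocal, ← ofOrder_add, ← degSum_add]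
    refine congrArg _ (funext fun j => funext fun k => congrArg _ (funext fun n =>
      funext fun m => ?_))
    simp only [Pi.add_apply]; ring
  map_smul' a B := by
    simp only [multipoleToLocal, RingHom.id_apply, ← ofOrder_mul, mul_degSum]
    refine congrArg _ (funext fun j => funext fun k => congrArg _ (funext fun n =>
      funext fun m => ?_))
    simp only [Pi.smul_apply, smul_eq_mul]; ring

/-! ### Exactness of the translations between expansions of the same kind -/

theorem sqrt_two_mul_add_one_ne_zero (n : ℕ) : (√(2 * n + 1 : ℝ) : ℂ) ≠ 0 := by
  rw [Ne, Complex.ofReal_eq_zero]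
  have : (0 : ℝ) < 2 * n + 1 := by positivity
  positivity

theorem sqrt_two_mul_add_one_mul_self (n : ℕ) :
    (√(2 * n + 1 : ℝ) : ℂ) * (√(2 * n + 1 : ℝ) : ℂ) = 2 * n + 1 := by
  rw [← Complex.ofReal_mul, Real.mul_self_sqrt (by positivity)]
  push_cast; ring

theorem ofReal_sqrt_div (n j : ℕ) :
    (√((2 * n + 1) / (2 * j + 1) : ℝ) : ℂ) =
      (√(2 * n + 1 : ℝ) : ℂ) / (√(2 * j + 1 : ℝ) : ℂ) := by
  rw [Real.sqrt_div (by positivity), Complex.ofReal_div]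

theorem ofReal_sqrt_four_pi_div (n : ℕ) :
    (√(4 * Real.pi / (2 * n + 1) : ℝ) : ℂ) =
      (√(4 * Real.pi) : ℂ) / (√(2 * n + 1 : ℝ) : ℂ) := by
  rw [Real.sqrt_div (by positivity), Complex.ofReal_div]

theorem sqrt_four_pi_ne_zero : (√(4 * Real.pi) : ℂ) ≠ 0 := by
  rw [Ne, Complex.ofReal_eq_zero]
  have := Real.pi_pos
  positivity

/-- The coefficient of a solid harmonic relative to its normalization in `harm`. -/
def harmWeight (n : ℕ) (m : ℤ) : ℂ := (√(2 * n + 1 : ℝ) : ℂ) * Complex.I ^ |m| / normA n m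

theorem harmWeight_ne_zero (n : ℕ) (m : ℤ) : harmWeight n m ≠ 0 :=
  div_ne_zero (mul_ne_zero (sqrt_two_mul_add_one_ne_zero n) (zpow_ne_zero _ Complex.I_ne_zero))
    (normA_ne_zero n m)

theorem sourceToMultipole_coeff_eq_harm (n : ℕ) (m : ℤ) (v : E3) :
    1 / (2 * n + 1) * (‖v‖ : ℂ) ^ n * Y n m v =
      (Complex.I ^ |m| / normA n m) / ((√(2 * n + 1 : ℝ) : ℂ) * (√(4 * Real.pi) : ℂ)) *
        harm n m v := by
  rw [harm_eq_solidReg, solidReg, ofReal_sqrt_four_pi_div, ← sqrt_two_mul_add_one_mul_self,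
    zpow_neg]
  have h1 := sqrt_two_mul_add_one_ne_zero n
  have h2 := sqrt_four_pi_ne_zero
  have h3 := normA_ne_zero n m
  have h4 : Complex.I ^ |m| ≠ 0 := zpow_ne_zero _ Complex.I_ne_zero
  field_simp

/-- Multipole-to-multipole translation is exact on the multipole expansion of a source. -/
theorem multipoleToMultipole_sourceToMultipole (s c c' : E3) (p : ℕ) :
    multipoleToMultipole c c' p p (sourceToMultipole p s c) = sourceToMultipole p s c' := by
  funext j k
  by_cases h : j ≤ p ∧ |k| ≤ (j : ℤ)
  swap
  · simp only [multipoleToMultipole, sourceToMultipole, ofOrder, if_neg h]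
  obtain ⟨hj, hk⟩ := h
  rw [multipoleToMultipole, ofOrder, if_pos ⟨hj, hk⟩, sourceToMultipole.eq_def p s c', ofOrder,
    if_pos ⟨hj, hk⟩, sourceToMultipole_coeff_eq_harm, show s - c' = (s - c) + (c - c') by abel, harm_add,
    Finset.mul_sum, degSum]
  symm
  refine Finset.sum_subset_zero_on_sdiff
    (Finset.range_subset_range.mpr (show j + 1 ≤ p + 1 by omega)) ?_ ?_
  · intro n hn
    simp only [Finset.mem_sdiff, Finset.mem_range] at hn
    exact Finset.sum_eq_zero fun m _ => if_neg (by omega)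
  · intro n hn
    rw [Finset.mem_range] at hn
    rw [Finset.mul_sum]
    refine Finset.sum_congr rfl fun m hm => ?_
    rw [Finset.mem_Icc] at hm
    rw [if_pos (by omega), sourceToMultipole, ofOrder, if_pos ⟨by omega, abs_le.mpr hm⟩,
      sourceToMultipole_coeff_eq_harm, harm_eq_solidReg (j - n), ofReal_sqrt_div,
      zpow_sub₀ Complex.I_ne_zero, zpow_sub₀ Complex.I_ne_zero, zpow_neg]
    have h1 := sqrt_two_mul_add_one_ne_zero n
    have h1' := sqrt_two_mul_add_one_ne_zero j
    have h2 := sqrt_four_pi_ne_zero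
    have h3 := normA_ne_zero n m
    have h4 : Complex.I ^ |m| ≠ 0 := zpow_ne_zero _ Complex.I_ne_zero
    have h5 : Complex.I ^ |k| ≠ 0 := zpow_ne_zero _ Complex.I_ne_zero
    have h6 : Complex.I ^ |k - m| ≠ 0 := zpow_ne_zero _ Complex.I_ne_zero
    have h7 := normA_ne_zero j k
    field_simp

/-- In suitably normalized coefficients, local-to-local translation is a correlation with the
regular solid harmonics. -/
theorem harmWeight_mul_localToLocal (c c' : E3) {p q : ℕ} (B : Coeffs) {j : ℕ} {k : ℤ}
    (hj : j ≤ q) (hk : |k| ≤ j) :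
    harmWeight j k * localToLocal c c' p q B j k = degSum p fun n m =>
      if j ≤ n then harm (n - j) (m - k) (c' - c) * (harmWeight n m * B n m) else 0 := by
  rw [localToLocal, ofOrder, if_pos ⟨hj, hk⟩, mul_degSum]
  refine degSum_congr fun n _ m _ => ?_
  split_ifs
  swap
  · simp
  rw [harm_eq_solidReg, ofReal_sqrt_div, zpow_sub₀ Complex.I_ne_zero,
    zpow_sub₀ Complex.I_ne_zero, zpow_neg, harmWeight, harmWeight]
  have h1 := sqrt_two_mul_add_one_ne_zero n
  have h1' := sqrt_two_mul_add_one_ne_zero j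
  have h3 := normA_ne_zero n m
  have h4 : Complex.I ^ |m| ≠ 0 := zpow_ne_zero _ Complex.I_ne_zero
  have h5 : Complex.I ^ |k| ≠ 0 := zpow_ne_zero _ Complex.I_ne_zero
  have h6 : Complex.I ^ |m - k| ≠ 0 := zpow_ne_zero _ Complex.I_ne_zero
  have h7 := normA_ne_zero j k
  field_simp

/-- The addition theorem, indexed as it occurs in the composition of two local-to-local
translations. -/
theorem degSum_harm_mul_harm {p j n' : ℕ} {k : ℤ} (m' : ℤ) (hn' : n' ≤ p) (hjn' : j ≤ n')
    (hk : |k| ≤ j) (u v : E3) :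
    degSum p (fun n m => if j ≤ n ∧ n ≤ n' then
      harm (n - j) (m - k) u * harm (n' - n) (m' - m) v else 0) =
      harm (n' - j) (m' - k) (u + v) := by
  have hk' := abs_le.mp hk
  rw [harm_add, degSum]
  symm
  rw [← Finset.sum_subset (s₁ := Finset.Ico j (n' + 1)) (s₂ := Finset.range (p + 1))]
  · rw [Finset.sum_Ico_eq_sum_range, show n' + 1 - j = n' - j + 1 by omega]
    refine Finset.sum_congr rfl fun i hi => ?_
    rw [Finset.mem_range] at hi
    rw [← Finset.sum_subset (s₁ := Finset.Icc (k - i) (k + i))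
      (s₂ := Finset.Icc (-((j + i : ℕ) : ℤ)) (j + i : ℕ))]
    · refine Finset.sum_bij (fun m _ => k + m) ?_ ?_ ?_ ?_
      · intro m hm; rw [Finset.mem_Icc] at hm ⊢; omega
      · intro a _ b _ h; omega
      · intro b hb
        rw [Finset.mem_Icc] at hb
        exact ⟨b - k, Finset.mem_Icc.mpr (by omega), by omega⟩
      · intro m _
        rw [if_pos (by omega), show j + i - j = i by omega, show k + m - k = m by omega,
          show n' - (j + i) = n' - j - i by omega, show m' - (k + m) = m' - k - m by omega]
    · intro m hm; rw [Finset.mem_Icc] at hm ⊢; push_cast; omega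
    · intro m _ hm
      rw [Finset.mem_Icc, not_and_or] at hm
      rw [if_pos (by omega), show j + i - j = i by omega, harm_eq_zero, zero_mul]
      rcases abs_cases (m - k) with h | h <;> omega
  · intro n hn; rw [Finset.mem_Ico] at hn; rw [Finset.mem_range]; omega
  · intro n _ hn
    rw [Finset.mem_Ico] at hn
    exact Finset.sum_eq_zero fun m _ => if_neg (by omega)

/-- Local-to-local translations of the same order compose exactly. -/
theorem localToLocal_localToLocal (c c' c'' : E3) (p q : ℕ) (B : Coeffs) :
    localToLocal c' c'' p q (localToLocal c c' p p B) = localToLocal c c'' p q B := by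
  funext j k
  by_cases h : j ≤ q ∧ |k| ≤ (j : ℤ)
  swap
  · simp only [localToLocal, ofOrder, if_neg h]
  obtain ⟨hj, hk⟩ := h
  apply mul_left_cancel₀ (harmWeight_ne_zero j k)
  rw [harmWeight_mul_localToLocal _ _ _ hj hk, harmWeight_mul_localToLocal _ _ _ hj hk]
  have h1 : (degSum p fun n m => if j ≤ n then harm (n - j) (m - k) (c'' - c') *
      (harmWeight n m * localToLocal c c' p p B n m) else 0) =
      degSum p fun n m => degSum p fun n' m' =>
        (if j ≤ n ∧ n ≤ n' then harm (n - j) (m - k) (c'' - c') *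
          harm (n' - n) (m' - m) (c' - c) else 0) * (harmWeight n' m' * B n' m') := by
    refine degSum_congr fun n hn m hm => ?_
    by_cases hjn : j ≤ n
    · rw [if_pos hjn, harmWeight_mul_localToLocal _ _ _ hn hm, mul_degSum]
      refine degSum_congr fun n' _ m' _ => ?_
      by_cases hnn : n ≤ n'
      · rw [if_pos hnn, if_pos ⟨hjn, hnn⟩, mul_assoc]
      · rw [if_neg hnn, if_neg (by tauto), mul_zero, zero_mul]
    · rw [if_neg hjn]
      symm
      refine Finset.sum_eq_zero fun n' _ => Finset.sum_eq_zero fun m' _ => ?_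
      simp only [if_neg (fun h : j ≤ n ∧ n ≤ n' => hjn h.1), zero_mul]
  rw [h1, degSum_comm]
  refine degSum_congr fun n' hn' m' _ => ?_
  simp only [mul_comm _ (harmWeight n' m' * B n' m')]
  rw [← mul_degSum]
  by_cases hjn : j ≤ n'
  · rw [if_pos hjn, degSum_harm_mul_harm m' hn' hjn hk,
      show c'' - c' + (c' - c) = c'' - c by abel]
  · rw [if_neg hjn, show (degSum p fun n m => if j ≤ n ∧ n ≤ n' then harm (n - j) (m - k) (c'' - c')
      * harm (n' - n) (m' - m) (c' - c) else 0) = 0 from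
        Finset.sum_eq_zero fun n _ => Finset.sum_eq_zero fun m _ => if_neg (by omega), mul_zero]

/-! ### Order zero: evaluation at the center -/

theorem Y_zero_zero (v : E3) : Y 0 0 v = (√(4 * Real.pi) : ℂ)⁻¹ := by
  simp [Y, sphY, assocLegendre]

theorem evalLocal_zero_self (B : Coeffs) (c : E3) :
    evalLocal 0 B c c = B 0 0 * (√(4 * Real.pi) : ℂ)⁻¹ := by
  simp [evalLocal, degSum, Y_zero_zero]

theorem normA_zero_zero : normA 0 0 = 1 := by
  simp [normA]

theorem evalLocal_sourceToLocal_zero (s c : E3) :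
    evalLocal 0 (sourceToLocal 0 s c) c c = (green c s : ℂ) := by
  have h : (√(4 * Real.pi) : ℂ)⁻¹ * (√(4 * Real.pi) : ℂ)⁻¹ = (((4 * Real.pi)⁻¹ : ℝ) : ℂ) := by
    rw [← mul_inv, ← Complex.ofReal_mul, Real.mul_self_sqrt (by positivity), Complex.ofReal_inv]
  rw [evalLocal_zero_self, green, Complex.ofReal_mul, ← h, norm_sub_rev c s]
  simp [sourceToLocal, ofOrder, Y_zero_zero]
  ring

/-- Converting a multipole expansion to a local expansion of order zero is evaluating it. -/
theorem evalLocal_multipoleToLocal_zero (c x : E3) (p : ℕ) (B : Coeffs) :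
    evalLocal 0 (multipoleToLocal c x p 0 B) x x = evalMultipole p B c x := by
  rw [evalLocal_zero_self, multipoleToLocal, ofOrder, if_pos (by simp), mul_comm, mul_degSum,
    evalMultipole]
  refine degSum_congr fun n _ m _ => ?_
  have h1 := sqrt_two_mul_add_one_ne_zero n
  have h2 := sqrt_four_pi_ne_zero
  have h3 := normA_ne_zero n m
  rw [ofReal_sqrt_div, solidIrr, Nat.add_zero, ofReal_sqrt_four_pi_div, normA_zero_zero]
  simp
  field_simp

/-- Translating a local expansion to one of order zero is evaluating it. -/
theorem evalLocal_localToLocal_zero (c x : E3) (p : ℕ) (B : Coeffs) :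
    evalLocal 0 (localToLocal c x p 0 B) x x = evalLocal p B c x := by
  rw [evalLocal_zero_self, localToLocal, ofOrder, if_pos (by simp), mul_comm, mul_degSum,
    evalLocal]
  refine degSum_congr fun n _ m _ => ?_
  have h1 := sqrt_two_mul_add_one_ne_zero n
  have h2 := sqrt_four_pi_ne_zero
  have h3 := normA_ne_zero n m
  rw [if_pos (Nat.zero_le n), ofReal_sqrt_div, solidReg, Nat.sub_zero, ofReal_sqrt_four_pi_div,
    normA_zero_zero]
  simp
  field_simp

end

/-! ### Ancestors in the octree -/

namespace Box

/-- The box of level `l` that contains `b`, for `l ≤ b.level`: an ancestor of `b` or `b` itself. -/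
def up (l : ℕ) (b : Box) : Box := ⟨l, fun i => b.idx i / 2 ^ (b.level - l)⟩

/-- `e` is `d` or an ancestor of `d`. -/
def Covers (e d : Box) : Prop := d = e ∨ e.IsAncestor d

@[simp] theorem up_level (l : ℕ) (b : Box) : (b.up l).level = l := rfl

@[simp] theorem up_self (b : Box) : b.up b.level = b := by
  ext <;> simp [up]

theorem up_up {l m : ℕ} {b : Box} (h : l ≤ m) (hm : m ≤ b.level) : (b.up m).up l = b.up l := by
  ext i
  · rfl
  · simp only [up]
    rw [Int.ediv_ediv_of_nonneg (by positivity), ← pow_add]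
    congr 2
    omega

theorem isAncestor_iff {a d : Box} : a.IsAncestor d ↔ a.level < d.level ∧ d.up a.level = a := by
  refine and_congr_right fun _ => ⟨fun h => ?_, fun h i => ?_⟩
  · ext i
    · rfl
    · exact h i
  · exact congrFun (congrArg Box.idx h) i

theorem covers_iff {e d : Box} : e.Covers d ↔ e.level ≤ d.level ∧ d.up e.level = e := by
  rw [Covers, isAncestor_iff]
  constructor
  · rintro (rfl | h)
    · simp
    · exact ⟨h.1.le, h.2⟩
  · rintro ⟨h1, h2⟩
    rcases h1.eq_or_lt with h | h
    · left; rw [← h2, h, up_self]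
    · exact Or.inr ⟨h, h2⟩

theorem isChild_iff {d e : Box} : d.IsChild e ↔ d.level = e.level + 1 ∧ d.up e.level = e := by
  refine and_congr_right fun hl => ⟨fun h => ?_, fun h i => ?_⟩
  · ext i
    · rfl
    · simpa [up, hl] using h i
  · have := congrFun (congrArg Box.idx h) i
    simpa [up, hl] using this

theorem parent_eq {b : Box} (h : b.level ≠ 0) : b.parent = b.up (b.level - 1) := by
  ext i
  · rfl
  · simp [parent, up, show b.level - (b.level - 1) = 1 by omega]

theorem parent_up {b : Box} {l : ℕ} (hl : l + 1 ≤ b.level) : (b.up (l + 1)).parent = b.up l := by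
  rw [parent_eq (by simp), up_level, up_up (by omega) hl, Nat.add_sub_cancel]

theorem up_isChild {b : Box} {l : ℕ} (hl : l + 1 ≤ b.level) :
    (b.up (l + 1)).IsChild (b.up l) :=
  isChild_iff.mpr ⟨rfl, up_up (by simp) hl⟩

/-- The boxes of level `l` containing `b` and `s` are at most two boxes apart. -/
def NearAt (b s : Box) (l : ℕ) : Prop := ∀ i, |(b.up l).idx i - (s.up l).idx i| ≤ 2

theorem NearAt.of_succ {b s : Box} {l : ℕ} (hb : l + 1 ≤ b.level) (hs : l + 1 ≤ s.level)
    (h : b.NearAt s (l + 1)) : b.NearAt s l := by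
  intro i
  have h1 := (up_isChild hb).2 i
  have h2 := (up_isChild hs).2 i
  have h3 := abs_le.mp (h i)
  rw [abs_le]
  omega

theorem NearAt.of_le {b s : Box} {l m : ℕ} (hlm : l ≤ m) (hb : m ≤ b.level) (hs : m ≤ s.level)
    (h : b.NearAt s m) : b.NearAt s l := by
  induction m, hlm using Nat.le_induction with
  | base => exact h
  | succ m _ ih => exact ih (by omega) (by omega) (h.of_succ hb hs)

end Box

/-! ### Geometry of cubes -/

theorem linfDist_le_iff {x y : E3} {r : ℝ} (hr : 0 ≤ r) :
    linfDist x y ≤ r ↔ ∀ i, |x i - y i| ≤ r := by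
  rw [linfDist, dist_pi_le_iff hr]
  rfl

theorem linfDist_comm (x y : E3) : linfDist x y = linfDist y x := dist_comm _ _

theorem linfDist_triangle (x y z : E3) : linfDist x z ≤ linfDist x y + linfDist y z :=
  dist_triangle _ _ _

theorem linfDist_nonneg (x y : E3) : 0 ≤ linfDist x y := dist_nonneg

theorem linfDist_le_dist (x y : E3) : linfDist x y ≤ dist x y := by
  rw [linfDist_le_iff dist_nonneg, dist_eq_norm]
  exact fun i => PiLp.norm_apply_le (x - y) i

theorem dist_le_sqrt_three_mul (x y : E3) : dist x y ≤ √3 * linfDist x y := by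
  have h := (linfDist_le_iff (linfDist_nonneg x y)).mp le_rfl
  rw [EuclideanSpace.dist_eq, Fin.sum_univ_three]
  refine Real.sqrt_le_iff.mpr ⟨mul_nonneg (Real.sqrt_nonneg _) (linfDist_nonneg _ _), ?_⟩
  rw [mul_pow, Real.sq_sqrt (by norm_num)]
  simp only [Real.dist_eq]
  have h' := fun i => pow_le_pow_left₀ (abs_nonneg _) (h i) 2
  linarith [h' 0, h' 1, h' 2]

namespace Octree

variable (T : Octree)

theorem radius_pos (b : Box) : 0 < T.radius b :=
  div_pos T.rootRadius_pos (by positivity)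

theorem radius_eq_of_level {a b : Box} (h : a.level = b.level) : T.radius a = T.radius b := by
  rw [radius, radius, h]

theorem center_apply (b : Box) (i : Fin 3) :
    T.center b i = T.rootCenter i - T.rootRadius + (2 * (b.idx i : ℝ) + 1) * T.radius b := rfl

theorem minRadius_le {b : Box} (hb : b ∈ T.boxes) : T.minRadius ≤ T.radius b :=
  Finset.inf'_le _ hb

theorem minRadius_pos : 0 < T.minRadius := by
  refine (Finset.lt_inf'_iff _).mpr ?_
  exact fun b _ => T.radius_pos b

theorem radius_of_isChild {d e : Box} (h : d.IsChild e) : T.radius e = 2 * T.radius d := by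
  rw [radius, radius, h.1, pow_succ]
  field_simp

theorem linfDist_center_of_isChild {d e : Box} (h : d.IsChild e) :
    linfDist (T.center d) (T.center e) ≤ T.radius d := by
  rw [linfDist_le_iff (T.radius_pos d).le]
  intro i
  have hr := T.radius_pos d
  rw [center_apply, center_apply, T.radius_of_isChild h]
  have : d.idx i = 2 * e.idx i ∨ d.idx i = 2 * e.idx i + 1 := by
    have := h.2 i
    omega
  rw [abs_le]
  rcases this with h' | h' <;> rw [h'] <;> push_cast <;> constructor <;> nlinarith

theorem center_sub_center {a b : Box} (h : a.level = b.level) (i : Fin 3) :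
    T.center a i - T.center b i = 2 * T.radius b * ((a.idx i - b.idx i : ℤ) : ℝ) := by
  rw [center_apply, center_apply, T.radius_eq_of_level h]
  push_cast
  ring

theorem mem_region_iff {x : E3} {b : Box} : x ∈ T.region b ↔ linfDist x (T.center b) ≤ T.radius b :=
  Iff.rfl

theorem region_subset_of_isChild {d e : Box} (h : d.IsChild e) : T.region d ⊆ T.region e := by
  intro x hx
  rw [mem_region_iff] at hx ⊢
  rw [T.radius_of_isChild h]
  linarith [linfDist_triangle x (T.center d) (T.center e), T.linfDist_center_of_isChild h]

theorem region_up_subset {b : Box} {l m : ℕ} (hlm : l ≤ m) (hm : m ≤ b.level) :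
    T.region (b.up m) ⊆ T.region (b.up l) := by
  induction m, hlm using Nat.le_induction with
  | base => exact subset_rfl
  | succ m _ ih =>
    exact (T.region_subset_of_isChild (Box.up_isChild hm)).trans (ih (by omega))

theorem region_subset_of_covers {e d : Box} (h : e.Covers d) : T.region d ⊆ T.region e := by
  obtain ⟨h1, h2⟩ := Box.covers_iff.mp h
  have := T.region_up_subset h1 le_rfl
  rwa [h2, Box.up_self] at this

theorem center_mem_region (b : Box) : T.center b ∈ T.region b := by
  rw [mem_region_iff, linfDist, dist_self]
  exact (T.radius_pos b).le

theorem up_mem {b : Box} (hb : b ∈ T.boxes) {l : ℕ} (hl : l ≤ b.level) : b.up l ∈ T.boxes := by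
  induction hl using Nat.decreasingInduction with
  | self => simpa using hb
  | of_succ l hl ih =>
    have hne : b.up (l + 1) ≠ Box.root := fun h => by
      simpa [Box.root] using congrArg Box.level h
    have := (T.parent_mem _ ih hne).2
    rwa [Box.parent_up hl] at this

theorem eq_root {b : Box} (hb : b ∈ T.boxes) (h : b.level = 0) : b = Box.root := by
  by_contra hne
  exact (T.parent_mem b hb hne).1 h

theorem nearAt_zero {b s : Box} (hb : b ∈ T.boxes) (hs : s ∈ T.boxes) : b.NearAt s 0 := by
  intro i
  rw [T.eq_root (T.up_mem hb (Nat.zero_le _)) rfl, T.eq_root (T.up_mem hs (Nat.zero_le _)) rfl]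
  simp

theorem adjacent_of_covers {a b : Box} (h : b.Covers a) : T.Adjacent a b :=
  ⟨T.center a, T.center_mem_region a, T.region_subset_of_covers h (T.center_mem_region a)⟩

theorem colleague_two_iff {b d : Box} (hd : d ∈ T.boxes) (hl : d.level = b.level) :
    T.Colleague 2 b d ↔ ∀ i, |b.idx i - d.idx i| ≤ 2 := by
  have hr := T.radius_pos b
  have hrd := T.radius_eq_of_level hl
  rw [Colleague, nearNeighborhood]
  constructor
  · rintro ⟨_, _, h⟩ i
    -- the two opposite corners of `d` lie in the neighborhood of `b`
    have key : ∀ σ : ℝ, |σ| ≤ 1 → |T.center d i + σ * T.radius b - T.center b i| ≤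
        T.radius b * (1 + 2 * (2 : ℕ)) := by
      intro σ hσ
      have hmem : (WithLp.toLp 2 fun j => T.center d j + σ * T.radius b : E3) ∈ T.region d := by
        rw [mem_region_iff, linfDist_le_iff (T.radius_pos d).le]
        intro j
        rw [hrd]
        simpa [abs_mul, abs_of_pos hr] using mul_le_of_le_one_left hr.le hσ
      exact (linfDist_le_iff (by positivity)).mp (h hmem) i
    have h1 := abs_le.mp (key 1 (by norm_num))
    have h2 := abs_le.mp (key (-1) (by norm_num))
    have h3 := T.center_sub_center hl i
    push_cast at h1 h2
    rw [abs_sub_comm, abs_le]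
    constructor
    · have : (-2 : ℝ) ≤ ((d.idx i - b.idx i : ℤ) : ℝ) := by
        by_contra hc; push Not at hc; nlinarith
      exact_mod_cast this
    · have : ((d.idx i - b.idx i : ℤ) : ℝ) ≤ 2 := by
        by_contra hc; push Not at hc; nlinarith
      exact_mod_cast this
  · intro h
    refine ⟨hd, hl, fun x hx => ?_⟩
    rw [mem_region_iff] at hx
    have hc : linfDist (T.center d) (T.center b) ≤ 4 * T.radius b := by
      rw [linfDist_le_iff (by positivity)]
      intro i
      have h2 : |((d.idx i - b.idx i : ℤ) : ℝ)| ≤ 2 := by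
        rw [← Int.cast_abs, abs_sub_comm]; exact_mod_cast h i
      rw [T.center_sub_center hl i, abs_mul, abs_of_pos (by positivity : 0 < 2 * T.radius b)]
      nlinarith
    show linfDist x (T.center b) ≤ _
    push_cast
    linarith [linfDist_triangle x (T.center d) (T.center b)]

theorem colleague_up_iff {b s : Box} (hs : s ∈ T.boxes) {l : ℕ} (hls : l ≤ s.level) :
    T.Colleague 2 (b.up l) (s.up l) ↔ b.NearAt s l :=
  T.colleague_two_iff (T.up_mem hs hls) rfl

/-- Touching boxes have nearby ancestors at every common level. -/
theorem nearAt_of_adjacent {b s : Box} (h : T.Adjacent s b) {l : ℕ} (hb : l ≤ b.level)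
    (hs : l ≤ s.level) : b.NearAt s l := by
  obtain ⟨x, hxs, hxb⟩ := h
  have h1 := T.region_up_subset hs le_rfl (by simpa using hxs)
  have h2 := T.region_up_subset hb le_rfl (by simpa using hxb)
  rw [mem_region_iff, linfDist_le_iff (T.radius_pos _).le] at h1 h2
  intro i
  have hr := T.radius_pos (b.up l)
  have h1 := abs_le.mp (h1 i)
  have h2 := abs_le.mp (h2 i)
  have h3 := T.center_sub_center (a := b.up l) (b := s.up l) rfl i
  rw [T.radius_eq_of_level (show (s.up l).level = (b.up l).level from rfl)] at h1 h3
  rw [abs_le]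
  constructor
  · have : (-2 : ℝ) ≤ (((b.up l).idx i - (s.up l).idx i : ℤ) : ℝ) := by
      by_contra hc; push Not at hc; nlinarith
    exact_mod_cast this
  · have : (((b.up l).idx i - (s.up l).idx i : ℤ) : ℝ) ≤ 2 := by
      by_contra hc; push Not at hc; nlinarith
    exact_mod_cast this

theorem BoxSepTCR.of_isChild {tf : ℝ} {d e b : Box} (hc : d.IsChild e)
    (h : T.BoxSepTCR tf e b) : T.BoxSepTCR tf d b := by
  intro x hx
  have h0 := h x hx
  have h1 := dist_le_sqrt_three_mul (T.center d) (T.center e)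
  have h2 := T.linfDist_center_of_isChild hc
  have h3 : √3 * linfDist (T.center d) (T.center e) ≤ 2 * T.radius d := by
    have : √3 ≤ 2 := Real.sqrt_le_iff.mpr (by norm_num)
    have := linfDist_nonneg (T.center d) (T.center e)
    gcongr
  have h4 := dist_triangle (T.center e) (T.center d) x
  rw [dist_comm (T.center e) (T.center d)] at h4
  rw [T.radius_of_isChild hc] at h0
  have := T.radius_pos d
  linarith

theorem TCRSepBox.of_isChild {tf : ℝ} (htf : 0 ≤ tf) {d e b : Box} (hc : d.IsChild e)
    (h : T.TCRSepBox tf e b) : T.TCRSepBox tf d b := by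
  intro x hx
  have h0 := h x hx
  have h2 := T.linfDist_center_of_isChild hc
  have h4 := linfDist_triangle (T.center e) (T.center d) x
  rw [linfDist_comm (T.center e) (T.center d)] at h4
  rw [T.radius_of_isChild hc] at h0
  have := T.radius_pos d
  have : 0 ≤ T.radius d * tf := by positivity
  linarith

end Octree

/-! ### Counting with persistent properties -/

open Classical in
/-- The indicator of a proposition. -/
noncomputable def ind (P : Prop) : ℕ := if P then 1 else 0

theorem ind_of {P : Prop} (h : P) : ind P = 1 := if_pos h

theorem ind_of_not {P : Prop} (h : ¬ P) : ind P = 0 := if_neg h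

/-- A property of natural numbers that persists once it holds becomes true at most once. -/
theorem sum_first_time (P : ℕ → Prop) (n : ℕ) (h : ∀ l < n, P l → P (l + 1)) :
    ∑ l ∈ Finset.range (n + 1), ind (P l ∧ (l = 0 ∨ ¬ P (l - 1))) = ind (P n) := by
  induction n with
  | zero => rw [Finset.sum_range_one]; simp
  | succ n ih =>
    rw [Finset.sum_range_succ, ih fun l hl => h l (by omega)]
    have := h n (by omega)
    by_cases h1 : P n
    · simp [h1, this h1, ind_of, ind_of_not]
    · by_cases h2 : P (n + 1) <;> simp [h1, h2, ind_of, ind_of_not]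

theorem sum_ind_eq_card {α : Type*} (D : Finset α) (P : α → Prop) [DecidablePred P] :
    ∑ d ∈ D, ind (P d) = (D.filter P).card := by
  rw [Finset.card_filter]
  refine Finset.sum_congr rfl fun d _ => ?_
  split_ifs with h
  · exact ind_of h
  · exact ind_of_not h

/-- The members of a set of boxes that cover a given box, counted level by level. -/
theorem sum_covers_eq_sum (D : Finset Box) (s : Box) :
    ∑ d ∈ D, ind (d.Covers s) = ∑ l ∈ Finset.range (s.level + 1), ind (s.up l ∈ D) := by
  classical
  rw [sum_ind_eq_card, sum_ind_eq_card]
  refine Finset.card_bij (fun d _ => d.level) ?_ ?_ ?_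
  · intro d hd
    rw [Finset.mem_filter] at hd ⊢
    obtain ⟨h1, h2⟩ := Box.covers_iff.mp hd.2
    rw [h2]
    exact ⟨Finset.mem_range.mpr (by omega), hd.1⟩
  · intro a ha b hb hab
    rw [Finset.mem_filter] at ha hb
    rw [← (Box.covers_iff.mp ha.2).2, ← (Box.covers_iff.mp hb.2).2, hab]
  · intro l hl
    rw [Finset.mem_filter, Finset.mem_range] at hl
    exact ⟨s.up l, Finset.mem_filter.mpr ⟨hl.2, Box.covers_iff.mpr ⟨by simp; omega, by simp⟩⟩, rfl⟩

namespace FMMTree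

variable {Γ : Set E3} {X : QBXData Γ} {tf : ℝ} (T : FMMTree X tf)

theorem mem_list1_iff {b s : Box} (hs : T.IsLeaf s) : s ∈ T.list1 b ↔ T.Adjacent s b := by
  classical
  rw [list1, Finset.mem_filter]
  constructor
  · rintro ⟨_, _, h | h | h⟩
    · exact T.adjacent_of_covers (Or.inr h)
    · exact T.adjacent_of_covers (Or.inl h)
    · exact h
  · exact fun h => ⟨hs.1, hs, Or.inr (Or.inr h)⟩

theorem adjacent_up_mono_left {b s : Box} {l m : ℕ} (hlm : l ≤ m) (hm : m ≤ s.level)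
    (h : T.Adjacent (s.up m) b) : T.Adjacent (s.up l) b :=
  h.mono (Set.inter_subset_inter_left _ (T.region_up_subset hlm hm))

theorem adjacent_up_mono_right {b s : Box} {l m : ℕ} (hlm : l ≤ m) (hm : m ≤ b.level)
    (h : T.Adjacent s (b.up m)) : T.Adjacent s (b.up l) :=
  h.mono (Set.inter_subset_inter_right _ (T.region_up_subset hlm hm))

/-! ### List 2 -/

theorem mem_list2_iff {b s : Box} (hb : b ∈ T.boxes) (hs : s ∈ T.boxes) {l l' : ℕ}
    (hl : l ≤ b.level) (hl' : l' ≤ s.level) :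
    s.up l' ∈ T.list2 (b.up l) ↔
      l' = l ∧ l ≠ 0 ∧ b.NearAt s (l - 1) ∧ ¬ b.NearAt s l := by
  classical
  rw [list2, Finset.mem_filter]
  constructor
  · rintro ⟨hmem, hroot, ⟨e, he, hc⟩, hlev, hw⟩
    have h1 : l' = l := hlev
    subst h1
    have h0 : l' ≠ 0 := fun h => hroot (T.eq_root (T.up_mem hb hl) h)
    obtain ⟨k, rfl⟩ := Nat.exists_eq_succ_of_ne_zero h0
    refine ⟨rfl, h0, ?_, fun h => hw ((T.colleague_up_iff hs hl').mpr h)⟩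
    rw [Box.parent_up hl] at he
    obtain ⟨hlv, hup⟩ := Box.isChild_iff.mp hc
    have hek : e.level = k := by
      have : k + 1 = e.level + 1 := hlv
      omega
    rw [hek, Box.up_up (by omega) hl'] at hup
    rw [← hup] at he
    exact (T.colleague_up_iff hs (by omega)).mp he
  · rintro ⟨rfl, h0, hn, hf⟩
    obtain ⟨k, rfl⟩ := Nat.exists_eq_succ_of_ne_zero h0
    refine ⟨T.up_mem hs hl', fun h => ?_, ⟨s.up k, ?_, Box.up_isChild hl'⟩, rfl, fun h => ?_⟩
    · simpa [Box.root] using congrArg Box.level h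
    · rw [Box.parent_up hl]
      exact (T.colleague_up_iff hs (by omega)).mpr hn
    · exact hf ((T.colleague_up_iff hs hl').mp h)

/-- The List 2 boxes of `b` and its ancestors cover `s` once if the ancestors of `b` and `s` at
their finest common level are `2`-well-separated, and not at all otherwise. -/
theorem list2_count {b s : Box} (hb : b ∈ T.boxes) (hs : s ∈ T.boxes) :
    (∑ l ∈ Finset.range (b.level + 1),
      (∑ d ∈ T.list2 (b.up l), ind (d.Covers s))) =
      ind (¬ b.NearAt s (min b.level s.level)) := by
  have hP : ∀ l < b.level, ¬ b.NearAt s (min l s.level) → ¬ b.NearAt s (min (l + 1) s.level) :=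
    fun l hl h h' => h (h'.of_le (by omega) (by omega) (by omega))
  rw [← sum_first_time (fun l => ¬ b.NearAt s (min l s.level)) b.level hP]
  refine Finset.sum_congr rfl fun l hl => ?_
  rw [Finset.mem_range] at hl
  have h0 := T.nearAt_zero hb hs
  have hsum : ∀ l' ∈ Finset.range (s.level + 1),
      ind (s.up l' ∈ T.list2 (b.up l)) =
      if l' = l then (ind (l ≠ 0 ∧ b.NearAt s (l - 1) ∧ ¬ b.NearAt s l)) else 0 := by
    intro l' hl'
    rw [Finset.mem_range] at hl'
    rw [T.mem_list2_iff hb hs (by omega) (by omega)]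
    split_ifs with h
    · simp [h]
    · exact ind_of_not fun h' => h h'.1
  have hand : ∀ P Q : Prop, [Decidable P] → (if P then ind Q else 0) = ind (P ∧ Q) := by
    intro P Q _
    split_ifs with h
    · simp [h]
    · exact (ind_of_not fun h' => h h'.1).symm
  rw [sum_covers_eq_sum, Finset.sum_congr rfl hsum, Finset.sum_ite_eq', hand]
  congr 1
  rw [Finset.mem_range, eq_iff_iff]
  rcases Nat.eq_zero_or_pos l with rfl | hpos
  · simp [h0]
  rcases Nat.lt_or_ge s.level l with h | h
  · have e1 : min l s.level = min (l - 1) s.level := by omega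
    rw [e1]
    constructor
    · omega
    · rintro ⟨h1, h2 | h2⟩
      · omega
      · exact absurd h1 h2
  · rw [min_eq_left h, min_eq_left (by omega : l - 1 ≤ s.level), not_not]
    constructor
    · rintro ⟨_, _, h2, h3⟩; exact ⟨h3, Or.inr h2⟩
    · rintro ⟨h1, h2 | h2⟩
      · omega
      · exact ⟨by omega, by omega, h2, h1⟩

/-! ### List 4 -/

/-- The box `s` is not finer than level `l`, is a `2`-colleague of the box of its own level that
contains `b`, and does not touch `b.up l`. This holds from the level on at which `s` enters List 4. -/
def Entered4 (b s : Box) (l : ℕ) : Prop :=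
  s.level ≤ l ∧ b.NearAt s s.level ∧ ¬ T.Adjacent s (b.up l)

theorem Entered4.mono {b s : Box} {l m : ℕ} (hlm : l ≤ m) (hm : m ≤ b.level)
    (h : T.Entered4 b s l) : T.Entered4 b s m :=
  ⟨h.1.trans hlm, h.2.1, fun h' => h.2.2 (T.adjacent_up_mono_right hlm hm h')⟩

theorem mem_list4_iff {b s : Box} (hb : b ∈ T.boxes) (hs : s ∈ T.boxes) (hsrc : T.IsSourceBox s)
    {l : ℕ} (hl : l ≤ b.level) :
    s ∈ T.list4 (b.up l) ↔ T.Entered4 b s l ∧ (l = 0 ∨ ¬ T.Entered4 b s (l - 1)) := by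
  have hcol : s.level ≤ b.level → (T.Colleague 2 (b.up s.level) s ↔ b.NearAt s s.level) := by
    intro _
    simpa using T.colleague_up_iff (b := b) hs le_rfl
  classical
  rw [list4, Finset.mem_filter]
  constructor
  · rintro ⟨_, _, ⟨⟨a, _, ha, hc⟩, hadj, hnadj⟩ | ⟨hc, hnadj⟩⟩
    · obtain ⟨hal, hup⟩ := Box.isAncestor_iff.mp ha
      rw [Box.up_level] at hal
      have hlev : s.level = a.level := hc.2.1
      rw [Box.up_up (by omega) hl, ← hlev] at hup
      rw [← hup] at hc
      refine ⟨⟨by omega, (hcol (by omega)).mp hc, hnadj⟩, Or.inr fun h => h.2.2 ?_⟩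
      obtain ⟨k, rfl⟩ := Nat.exists_eq_succ_of_ne_zero (by omega : l ≠ 0)
      rwa [Box.parent_up hl] at hadj
    · have hlev : s.level = l := hc.2.1
      subst hlev
      refine ⟨⟨le_rfl, (hcol hl).mp hc, hnadj⟩, ?_⟩
      by_cases h0 : s.level = 0
      · exact Or.inl h0
      · exact Or.inr fun h => by have := h.1; omega
  · rintro ⟨⟨h1, h2, h3⟩, h4⟩
    refine ⟨hs, hsrc, ?_⟩
    rcases h1.eq_or_lt with h | h
    · subst h
      exact Or.inr ⟨(hcol hl).mpr h2, h3⟩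
    · obtain ⟨k, rfl⟩ := Nat.exists_eq_succ_of_ne_zero (by omega : l ≠ 0)
      left
      refine ⟨⟨b.up s.level, T.up_mem hb (by omega), ?_, (hcol (by omega)).mpr h2⟩, ?_, h3⟩
      · exact Box.isAncestor_iff.mpr ⟨h, Box.up_up (by simpa using h.le) hl⟩
      · rw [Box.parent_up hl]
        rcases h4 with h4 | h4
        · omega
        · by_contra hc
          exact h4 ⟨by simpa using Nat.le_of_lt_succ h, h2, hc⟩

theorem mem_list4close_iff {b s : Box} (hb : b ∈ T.boxes) (hs : s ∈ T.boxes)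
    (hsrc : T.IsSourceBox s) {l : ℕ} (hl : l ≤ b.level) :
    s ∈ T.list4close (b.up l) ↔ T.Entered4 b s l ∧ ¬ T.TCRSepBox tf (b.up l) s := by
  classical
  rw [list4close, Finset.mem_filter]
  constructor
  · rintro ⟨_, ⟨w, _, hw, h4⟩, hsep⟩
    refine ⟨?_, hsep⟩
    obtain ⟨h1, h2⟩ := Box.covers_iff.mp (show w.Covers (b.up l) by
      rcases hw with hw | hw
      · exact Or.inr hw
      · exact Or.inl hw.symm)
    rw [Box.up_level] at h1
    rw [Box.up_up h1 hl] at h2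
    rw [← h2, T.mem_list4_iff hb hs hsrc (by omega)] at h4
    exact h4.1.mono T h1 hl
  · rintro ⟨h, hsep⟩
    refine ⟨hs, ?_, hsep⟩
    -- the level at which `s` enters List 4
    let P : ℕ → Prop := fun k => T.Entered4 b s k
    have hex : ∃ k, P k := ⟨l, h⟩
    classical
    have hk := Nat.find_spec hex
    have hkl : Nat.find hex ≤ l := Nat.find_min' hex h
    refine ⟨b.up (Nat.find hex), T.up_mem hb (by omega), ?_,
      (T.mem_list4_iff hb hs hsrc (by omega)).mpr ⟨hk, ?_⟩⟩
    · rcases hkl.eq_or_lt with h' | h'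
      · right; rw [h']
      · left; exact Box.isAncestor_iff.mpr ⟨h', Box.up_up hkl hl⟩
    · by_cases h0 : Nat.find hex = 0
      · exact Or.inl h0
      · exact Or.inr (Nat.find_min hex (by omega))

theorem mem_list4far_iff {b s : Box} (hb : b ∈ T.boxes) (hs : s ∈ T.boxes)
    (hsrc : T.IsSourceBox s) {l : ℕ} (hl : l ≤ b.level) :
    s ∈ T.list4far (b.up l) ↔ (T.Entered4 b s l ∧ T.TCRSepBox tf (b.up l) s) ∧
      (l = 0 ∨ ¬ (T.Entered4 b s (l - 1) ∧ T.TCRSepBox tf (b.up (l - 1)) s)) := by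
  classical
  rw [list4far, Finset.mem_filter, T.mem_list4_iff hb hs hsrc hl]
  rcases Nat.eq_zero_or_pos l with rfl | hpos
  · have : b.up 0 = Box.root := T.eq_root (T.up_mem hb (Nat.zero_le _)) rfl
    simp [this, hs]
  · obtain ⟨k, rfl⟩ := Nat.exists_eq_succ_of_ne_zero hpos.ne'
    have hroot : b.up (k + 1) ≠ Box.root := fun h => by
      simpa [Box.root] using congrArg Box.level h
    have hmono : T.Entered4 b s k → T.Entered4 b s (k + 1) := fun h => h.mono T (by omega) hl
    rw [Nat.succ_eq_add_one, Nat.add_sub_cancel, Box.parent_up hl,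
      T.mem_list4close_iff hb hs hsrc (by omega)]
    have : k + 1 ≠ 0 := by omega
    tauto

/-- The List 4 far boxes of `b` and its ancestors, together with List 4 close of `b`, contain `s`
once if `s` enters List 4 of `b` or of an ancestor, and not at all otherwise. -/
theorem list4_count (htf : 0 ≤ tf) {b s : Box} (hb : b ∈ T.boxes) (hs : s ∈ T.boxes)
    (hsrc : T.IsSourceBox s) :
    ind (s ∈ T.list4close b) +
      (∑ l ∈ Finset.range (b.level + 1), ind (s ∈ T.list4far (b.up l))) =
      ind (T.Entered4 b s b.level) := by
  have hclose := T.mem_list4close_iff hb hs hsrc le_rfl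
  rw [Box.up_self] at hclose
  have hfar : (∑ l ∈ Finset.range (b.level + 1), ind (s ∈ T.list4far (b.up l))) =
      ind (T.Entered4 b s b.level ∧ T.TCRSepBox tf (b.up b.level) s) := by
    rw [← sum_first_time (fun l => T.Entered4 b s l ∧ T.TCRSepBox tf (b.up l) s) b.level]
    · refine Finset.sum_congr rfl fun l hl => ?_
      rw [Finset.mem_range] at hl
      congr 1
      rw [T.mem_list4far_iff hb hs hsrc (by omega)]
    · exact fun l hl h => ⟨h.1.mono T (by omega) hl, h.2.of_isChild _ htf (Box.up_isChild hl)⟩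
  rw [hfar, hclose, Box.up_self]
  by_cases h1 : T.Entered4 b s b.level <;> by_cases h2 : T.TCRSepBox tf b s <;>
    simp [h1, h2, ind_of, ind_of_not]

/-! ### List 3 -/

/-- The box `s.up l` is a descendant of a `2`-colleague of `b` and does not touch `b`: it is in
List 3 of `b` or a descendant of a box in List 3. -/
def Entered3 (b s : Box) (l : ℕ) : Prop :=
  b.level < l ∧ b.NearAt s b.level ∧ ¬ T.Adjacent (s.up l) b

theorem Entered3.mono {b s : Box} {l m : ℕ} (hlm : l ≤ m) (hm : m ≤ s.level)
    (h : T.Entered3 b s l) : T.Entered3 b s m :=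
  ⟨h.1.trans_le hlm, h.2.1, fun h' => h.2.2 (T.adjacent_up_mono_left hlm hm h')⟩

theorem inDescColleagues_iff {b s : Box} (hs : s ∈ T.boxes) {l : ℕ} (hl : l ≤ s.level) :
    T.InDescColleagues b (s.up l) ↔ b.level < l ∧ b.NearAt s b.level := by
  constructor
  · rintro ⟨_, e, he, ha⟩
    obtain ⟨h1, h2⟩ := Box.isAncestor_iff.mp ha
    have hlev : e.level = b.level := he.2.1
    rw [Box.up_level] at h1
    rw [Box.up_up h1.le hl, hlev] at h2
    rw [← h2] at he
    refine ⟨by omega, (T.colleague_up_iff hs (by omega)).mp ?_⟩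
    rwa [Box.up_self]
  · rintro ⟨h1, h2⟩
    refine ⟨T.up_mem hs hl, s.up b.level, ?_, Box.isAncestor_iff.mpr ⟨h1, Box.up_up h1.le hl⟩⟩
    have := (T.colleague_up_iff hs (by omega)).mpr h2
    rwa [Box.up_self] at this

theorem mem_list3_iff {b s : Box} (hs : s ∈ T.boxes) {l : ℕ} (hl : l ≤ s.level) :
    s.up l ∈ T.list3 b ↔ T.Entered3 b s l ∧ ¬ T.Entered3 b s (l - 1) := by
  classical
  rw [list3, Finset.mem_filter, T.inDescColleagues_iff hs hl]
  constructor
  · rintro ⟨_, h1, h2, h3⟩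
    refine ⟨⟨h1.1, h1.2, h2⟩, fun h => h.2.2 (h3 _ ?_ ?_)⟩
    · have := h.1
      exact Box.isAncestor_iff.mpr ⟨by simp; omega, Box.up_up (by simp) hl⟩
    · exact (T.inDescColleagues_iff hs (by omega)).mpr ⟨h.1, h.2.1⟩
  · rintro ⟨⟨h1, h2, h3⟩, h4⟩
    refine ⟨T.up_mem hs hl, ⟨h1, h2⟩, h3, fun w hw hd => ?_⟩
    obtain ⟨h5, h6⟩ := Box.isAncestor_iff.mp hw
    rw [Box.up_level] at h5
    rw [Box.up_up h5.le hl] at h6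
    rw [← h6] at hd ⊢
    rw [T.inDescColleagues_iff hs (by omega)] at hd
    by_contra hc
    exact h4 (Entered3.mono T (by omega) (by omega) (⟨hd.1, hd.2, hc⟩ : T.Entered3 b s w.level))

theorem inDescList3_iff {b s : Box} (hs : s ∈ T.boxes) {l : ℕ} (hl : l ≤ s.level) :
    T.InDescList3 b (s.up l) ↔ T.Entered3 b s l := by
  constructor
  · rintro ⟨_, e, he, hc⟩
    obtain ⟨h1, h2⟩ := Box.covers_iff.mp hc
    rw [Box.up_level] at h1
    rw [Box.up_up h1 hl] at h2
    rw [← h2, T.mem_list3_iff hs (by omega)] at he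
    exact he.1.mono T h1 hl
  · intro h
    let P : ℕ → Prop := fun k => T.Entered3 b s k
    have hex : ∃ k, P k := ⟨l, h⟩
    classical
    have hk := Nat.find_spec hex
    have hkl : Nat.find hex ≤ l := Nat.find_min' hex h
    have hpos : b.level < Nat.find hex := hk.1
    exact ⟨T.up_mem hs hl, s.up (Nat.find hex),
      (T.mem_list3_iff hs (by omega)).mpr ⟨hk, Nat.find_min hex (by omega)⟩,
      Box.covers_iff.mpr ⟨hkl, Box.up_up hkl hl⟩⟩

theorem mem_list3close_iff {b s : Box} (hs : T.IsLeaf s) :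
    s ∈ T.list3close b ↔ T.Entered3 b s s.level ∧ ¬ T.BoxSepTCR tf s b := by
  have := T.inDescList3_iff (b := b) hs.1 le_rfl
  rw [Box.up_self] at this
  classical
  rw [list3close, Finset.mem_filter, this]
  exact ⟨fun h => h.2.2, fun h => ⟨hs.1, hs, h⟩⟩

theorem mem_list3far_iff {b s : Box} (hs : s ∈ T.boxes) {l : ℕ} (hl : l ≤ s.level) :
    s.up l ∈ T.list3far b ↔ (T.Entered3 b s l ∧ T.BoxSepTCR tf (s.up l) b) ∧
      (l = 0 ∨ ¬ (T.Entered3 b s (l - 1) ∧ T.BoxSepTCR tf (s.up (l - 1)) b)) := by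
  classical
  rw [list3far, Finset.mem_filter, T.inDescList3_iff hs hl]
  constructor
  · rintro ⟨_, h1, h2, h3⟩
    have hpos := h1.1
    refine ⟨⟨h1, h2⟩, Or.inr fun h => h3 (s.up (l - 1)) ?_ ?_ h.2⟩
    · exact Box.isAncestor_iff.mpr ⟨by simp; omega, Box.up_up (by simp) hl⟩
    · exact (T.inDescList3_iff hs (by omega)).mpr h.1
  · rintro ⟨⟨h1, h2⟩, h3⟩
    refine ⟨T.up_mem hs hl, h1, h2, fun w hw hd hsep => ?_⟩
    obtain ⟨h5, h6⟩ := Box.isAncestor_iff.mp hw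
    rw [Box.up_level] at h5
    rw [Box.up_up h5.le hl] at h6
    rw [← h6] at hd hsep
    rw [T.inDescList3_iff hs (by omega)] at hd
    have hstep : ∀ k, w.level ≤ k → k < l → T.BoxSepTCR tf (s.up k) b := by
      intro k hk
      induction k, hk using Nat.le_induction with
      | base => exact fun _ => hsep
      | succ k _ ih =>
        exact fun hkl => (ih (by omega)).of_isChild _ (Box.up_isChild (by omega))
    rcases h3 with h3 | h3
    · omega
    · exact h3 ⟨hd.mono T (by omega) (by omega), hstep _ (by omega) (by omega)⟩

/-- List 3 close contains `s`, or List 3 far covers it, once if `s` is in List 3 or below it, and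
not at all otherwise. -/
theorem list3_count {b s : Box} (hs : T.IsLeaf s) :
    ind (s ∈ T.list3close b) +
      (∑ d ∈ T.list3far b, ind (d.Covers s)) =
      ind (T.Entered3 b s s.level) := by
  have hfar : (∑ d ∈ T.list3far b, ind (d.Covers s)) =
      ind (T.Entered3 b s s.level ∧ T.BoxSepTCR tf (s.up s.level) b) := by
    rw [sum_covers_eq_sum,
      ← sum_first_time (fun l => T.Entered3 b s l ∧ T.BoxSepTCR tf (s.up l) b) s.level]
    · refine Finset.sum_congr rfl fun l hl => ?_
      rw [Finset.mem_range] at hl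
      congr 1
      rw [T.mem_list3far_iff hs.1 (by omega)]
    · exact fun l hl h => ⟨h.1.mono T (by omega) hl, h.2.of_isChild _ (Box.up_isChild hl)⟩
  rw [hfar, T.mem_list3close_iff hs, Box.up_self]
  by_cases h1 : T.Entered3 b s s.level <;> by_cases h2 : T.BoxSepTCR tf s b <;>
    simp [h1, h2, ind_of, ind_of_not]

/-! ### Every source is accounted for exactly once -/

/-- Exactly one of the following holds once: `s` is in one of the near lists of `b`, it is covered by
a List 3 far box of `b`, or it is covered by a List 2 box or is a List 4 far box of `b` or of an
ancestor of `b`. -/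
theorem interaction_count (htf : 0 ≤ tf) {b s : Box} (hb : b ∈ T.boxes) (hs : T.IsLeaf s)
    (hsrc : T.IsSourceBox s) :
    ind (s ∈ T.list1 b) + ind (s ∈ T.list3close b) +
      ind (s ∈ T.list4close b) +
      (∑ d ∈ T.list3far b, ind (d.Covers s)) +
      (∑ l ∈ Finset.range (b.level + 1), ((∑ d ∈ T.list2 (b.up l), ind (d.Covers s)) +
        ind (s ∈ T.list4far (b.up l)))) = 1 := by
  rw [Finset.sum_add_distrib]
  have h2 := T.list2_count hb hs.1
  have h3 := T.list3_count (b := b) hs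
  have h4 := T.list4_count htf hb hs.1 hsrc
  have key : ind (s ∈ T.list1 b) + ind (T.Entered3 b s s.level) +
      ind (T.Entered4 b s b.level) +
      ind (¬ b.NearAt s (min b.level s.level)) = 1 := by
    rw [T.mem_list1_iff hs, Entered3, Entered4, Box.up_self, Box.up_self]
    by_cases hadj : T.Adjacent s b
    · have := T.nearAt_of_adjacent hadj (min_le_left _ _) (min_le_right b.level s.level)
      simp [hadj, this, ind_of, ind_of_not]
    · rcases Nat.lt_or_ge b.level s.level with h | h
      · rw [min_eq_left h.le]
        have : ¬ s.level ≤ b.level := by omega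
        by_cases hn : b.NearAt s b.level <;> simp [hadj, hn, h, this, ind_of, ind_of_not]
      · rw [min_eq_right h]
        have : ¬ b.level < s.level := by omega
        by_cases hn : b.NearAt s s.level <;> simp [hadj, hn, h, this, ind_of, ind_of_not]
  omega

end FMMTree

namespace FMMTree

variable {Γ : Set E3} {X : QBXData Γ} {tf : ℝ} (T : FMMTree X tf)

/-! ### The algorithm as a sum over the sources -/

theorem sum_sum_owned {V : Type*} [AddCommMonoid V] (D : Finset Box)
    (f : Fin X.numSources → V) :
    ∑ d ∈ D, ∑ i ∈ T.owned d, f i = ∑ i, ind (T.sourceBox i ∈ D) • f i := by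
  classical
  have h : ∀ d ∈ D, ∑ i ∈ T.owned d, f i = ∑ i, if T.sourceBox i = d then f i else 0 := by
    intro d _
    rw [owned, Finset.sum_filter]
  rw [Finset.sum_congr rfl h, Finset.sum_comm]
  refine Finset.sum_congr rfl fun i _ => ?_
  rw [Finset.sum_ite_eq]
  split_ifs with h
  · rw [ind_of h, one_smul]
  · rw [ind_of_not h, zero_smul]

/-- A box covers another one if the two are equal or one of its children does. -/
theorem ind_covers_eq {d s : Box} (hs : s ∈ T.boxes) (h : ℕ) :
    ind (s = d) + ∑ e ∈ T.children d, ind (e.Covers s ∧ s.level ≤ e.level + h) =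
      ind (d.Covers s ∧ s.level ≤ d.level + (h + 1)) := by
  classical
  have hchild : ∀ e ∈ T.children d, e.IsChild d := by
    intro e he
    rw [Octree.children, Finset.mem_filter] at he
    exact he.2
  have hcov : ∀ e ∈ T.children d, e.Covers s →
      d.level + 1 ≤ s.level ∧ e = s.up (d.level + 1) ∧ s.up d.level = d := by
    intro e he hes
    obtain ⟨h1, h2⟩ := Box.isChild_iff.mp (hchild e he)
    obtain ⟨h3, h4⟩ := Box.covers_iff.mp hes
    rw [h1] at h3 h4
    refine ⟨h3, h4.symm, ?_⟩
    have := Box.up_up (l := d.level) (by omega) h3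
    rw [h4, h2] at this
    exact this.symm
  by_cases hd : d.Covers s ∧ s.level ≤ d.level + (h + 1)
  · rw [ind_of hd]
    obtain ⟨hdl, hdu⟩ := Box.covers_iff.mp hd.1
    rcases hdl.eq_or_lt with hl | hl
    · have : s = d := by rw [← hdu, hl, Box.up_self]
      rw [ind_of this, Finset.sum_eq_zero, Nat.add_zero]
      intro e he
      exact ind_of_not fun hc => by have := (hcov e he hc.1).1; omega
    · have : s ≠ d := fun h => by rw [h] at hl; omega
      have hc : (s.up (d.level + 1)).IsChild d := by
        have := Box.up_isChild (b := s) (l := d.level) hl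
        rwa [hdu] at this
      have hmem : s.up (d.level + 1) ∈ T.children d := by
        rw [Octree.children, Finset.mem_filter]
        exact ⟨T.up_mem hs hl, hc⟩
      rw [ind_of_not this, zero_add, Finset.sum_eq_single_of_mem _ hmem]
      · refine ind_of ⟨Box.covers_iff.mpr ⟨hl, rfl⟩, ?_⟩
        have := hd.2
        simp only [Box.up_level]
        omega
      · exact fun e he hne => ind_of_not fun hc => hne (hcov e he hc.1).2.1
  · rw [ind_of_not hd, ind_of_not, Finset.sum_eq_zero, Nat.add_zero]
    · intro e he
      refine ind_of_not fun hc => hd ?_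
      obtain ⟨h1, _, h3⟩ := hcov e he hc.1
      have h4 := (hchild e he).1
      exact ⟨Box.covers_iff.mpr ⟨by omega, h3⟩, by have := hc.2; omega⟩
    · rintro rfl
      exact hd ⟨Or.inl rfl, by omega⟩

theorem multipoleAux_eq (p : ℕ) (g : Fin X.numSources → ℝ) (h : ℕ) (d : Box) :
    T.multipoleAux p g h d = ∑ i,
      ind (d.Covers (T.sourceBox i) ∧ (T.sourceBox i).level ≤ d.level + h) •
        (g i : ℂ) • sourceToMultipole p (X.source i) (T.center d) := by
  have hown : ∀ d, T.ownMultipole p g d = ∑ i, ind (T.sourceBox i = d) •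
      (g i : ℂ) • sourceToMultipole p (X.source i) (T.center d) := by
    intro d
    have := T.sum_sum_owned {d} fun i => (g i : ℂ) • sourceToMultipole p (X.source i) (T.center d)
    simpa [ownMultipole] using this
  induction h generalizing d with
  | zero =>
    rw [multipoleAux, hown]
    refine Finset.sum_congr rfl fun i _ => ?_
    congr 2
    rw [eq_iff_iff]
    constructor
    · rintro rfl; exact ⟨Or.inl rfl, le_rfl⟩
    · rintro ⟨h1, h2⟩
      rcases h1 with h1 | h1
      · exact h1
      · have := h1.1; omega
  | succ h ih =>
    have hlin : ∀ e, multipoleToMultipole (T.center e) (T.center d) p p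
        (T.multipoleAux p g h e) = ∑ i,
          ind (e.Covers (T.sourceBox i) ∧ (T.sourceBox i).level ≤ e.level + h) •
            (g i : ℂ) • sourceToMultipole p (X.source i) (T.center d) := by
      intro e
      rw [ih]
      change multipoleToMultipoleLin _ _ p p _ = _
      rw [map_sum]
      refine Finset.sum_congr rfl fun i _ => ?_
      rw [map_nsmul, map_smul]
      congr 2
      exact multipoleToMultipole_sourceToMultipole _ _ _ p
    rw [multipoleAux, hown, Finset.sum_congr rfl fun e _ => hlin e, Finset.sum_comm,
      ← Finset.sum_add_distrib]
    refine Finset.sum_congr rfl fun i _ => ?_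
    rw [← Finset.sum_smul, ← add_smul, T.ind_covers_eq (T.source_leaf i).1]

/-- The multipole expansion of a box is exactly that of the sources inside it. -/
theorem multipole_eq (p : ℕ) (g : Fin X.numSources → ℝ) (d : Box) :
    T.multipole p g d = ∑ i, ind (d.Covers (T.sourceBox i)) •
        (g i : ℂ) • sourceToMultipole p (X.source i) (T.center d) := by
  rw [multipole, multipoleAux_eq]
  refine Finset.sum_congr rfl fun i _ => ?_
  congr 2
  have : (T.sourceBox i).level ≤ T.boxes.sup Box.level := Finset.le_sup (T.source_leaf i).1
  rw [eq_iff_iff]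
  exact ⟨fun h => h.1, fun h => ⟨h, by omega⟩⟩

/-- The contribution of a unit source at `y`, owned by the box `s`, to `incoming`. -/
noncomputable def unitIncoming (p : ℕ) (s : Box) (y : E3) (w : Box) : Coeffs :=
  ∑ d ∈ T.list2 w, ind (d.Covers s) •
    multipoleToLocal (T.center d) (T.center w) p p (sourceToMultipole p y (T.center d)) +
  ind (s ∈ T.list4far w) • sourceToLocal p y (T.center w)

/-- The contribution of a unit source at `y`, owned by the box `s`, to the coefficients at a QBX
center `c`. -/
noncomputable def unitCoeffs (p q : ℕ) (s : Box) (y : E3) (b : Box) (c : E3) : Coeffs :=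
  (ind (s ∈ T.list1 b) + ind (s ∈ T.list3close b) + ind (s ∈ T.list4close b)) •
    sourceToLocal q y c +
  ∑ d ∈ T.list3far b, ind (d.Covers s) •
    multipoleToLocal (T.center d) c p q (sourceToMultipole p y (T.center d)) +
  ∑ l ∈ Finset.range (b.level + 1),
    localToLocal (T.center (b.up l)) c p q (T.unitIncoming p s y (b.up l))

theorem sum_multipoleToLocal_multipole (p q : ℕ) (g : Fin X.numSources → ℝ) (D : Finset Box)
    (c : E3) :
    ∑ d ∈ D, multipoleToLocal (T.center d) c p q (T.multipole p g d) =
      ∑ i, (g i : ℂ) • ∑ d ∈ D, ind (d.Covers (T.sourceBox i)) •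
        multipoleToLocal (T.center d) c p q (sourceToMultipole p (X.source i) (T.center d)) := by
  have h : ∀ d ∈ D, multipoleToLocal (T.center d) c p q (T.multipole p g d) =
      ∑ i, (g i : ℂ) • ind (d.Covers (T.sourceBox i)) •
        multipoleToLocal (T.center d) c p q (sourceToMultipole p (X.source i) (T.center d)) := by
    intro d _
    rw [multipole_eq]
    change multipoleToLocalLin _ _ p q _ = _
    rw [map_sum]
    refine Finset.sum_congr rfl fun i _ => ?_
    rw [map_nsmul, map_smul, smul_comm]
    rfl
  rw [Finset.sum_congr rfl h, Finset.sum_comm]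
  simp only [Finset.smul_sum]

theorem incoming_eq (p : ℕ) (g : Fin X.numSources → ℝ) (w : Box) :
    T.incoming p g w = ∑ i, (g i : ℂ) • T.unitIncoming p (T.sourceBox i) (X.source i) w := by
  rw [incoming, sum_multipoleToLocal_multipole, T.sum_sum_owned, ← Finset.sum_add_distrib]
  refine Finset.sum_congr rfl fun i _ => ?_
  rw [unitIncoming, smul_add, smul_comm]

/-- Unrolling the downward pass: only the translation to the final center remains. -/
theorem localToLocal_localAux (p q : ℕ) (g : Fin X.numSources → ℝ) (c : E3) (k : ℕ) (b : Box)
    (hk : b.level = k) :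
    localToLocal (T.center b) c p q (T.localAux p g k b) =
      ∑ l ∈ Finset.range (k + 1),
        localToLocal (T.center (b.up l)) c p q (T.incoming p g (b.up l)) := by
  induction k generalizing b with
  | zero => rw [Finset.sum_range_one, ← hk, Box.up_self, hk, localAux]
  | succ k ih =>
    have hpar : b.parent = b.up k := by rw [Box.parent_eq (by omega), hk, Nat.add_sub_cancel]
    have hadd : ∀ B B', localToLocal (T.center b) c p q (B + B') =
        localToLocal (T.center b) c p q B + localToLocal (T.center b) c p q B' :=
      fun B B' => map_add (localToLocalLin (T.center b) c p q) B B'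
    rw [localAux, hadd, localToLocal_localToLocal, hpar, ih (b.up k) rfl,
      Finset.sum_range_succ _ (k + 1), add_comm]
    refine congrArg₂ (· + ·) ?_ ?_
    · refine Finset.sum_congr rfl fun l hl => ?_
      rw [Finset.mem_range] at hl
      rw [Box.up_up (by omega) (by omega)]
    · rw [← hk, Box.up_self]

theorem qbxCoeffs_eq (p q : ℕ) (g : Fin X.numSources → ℝ) (b : Box) (c : E3) :
    T.qbxCoeffs p q g b c =
      ∑ i, (g i : ℂ) • T.unitCoeffs p q (T.sourceBox i) (X.source i) b c := by
  have hloc : localToLocal (T.center b) c p q (T.localFar p g b) = ∑ i, (g i : ℂ) •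
      ∑ l ∈ Finset.range (b.level + 1), localToLocal (T.center (b.up l)) c p q
        (T.unitIncoming p (T.sourceBox i) (X.source i) (b.up l)) := by
    rw [localFar, T.localToLocal_localAux p q g c _ _ rfl]
    simp only [Finset.smul_sum]
    rw [Finset.sum_comm]
    refine Finset.sum_congr rfl fun l _ => ?_
    rw [incoming_eq]
    change localToLocalLin _ _ p q _ = _
    rw [map_sum]
    exact Finset.sum_congr rfl fun i _ => map_smul _ _ _
  rw [qbxCoeffs, hloc, sum_multipoleToLocal_multipole]
  simp only [T.sum_sum_owned]
  simp only [← Finset.sum_add_distrib]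
  refine Finset.sum_congr rfl fun i _ => ?_
  rw [unitCoeffs, smul_add, smul_add, add_smul, add_smul, smul_add, smul_add]
  simp only [smul_comm (g i : ℂ) (ind _)]

/-- The potential at a conventional target `x` is the value of the QBX expansion of order zero
centered at `x`. -/
theorem pointValue_eq (p : ℕ) (g : Fin X.numSources → ℝ) (b : Box) (x : E3) :
    T.pointValue p g b x = evalLocal 0 (T.qbxCoeffs p 0 g b x) x x := by
  change _ = evalLocalLin 0 x x _
  rw [qbxCoeffs, pointValue]
  simp only [map_add, map_sum, map_smul]
  simp only [evalLocalLin, LinearMap.coe_mk, AddHom.coe_mk, evalLocal_sourceToLocal_zero,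
    evalLocal_multipoleToLocal_zero, evalLocal_localToLocal_zero, smul_eq_mul]

end FMMTree

/-! ### Euclidean balls -/

theorem add_dist_le_of_closedBall_subset {c z : E3} {r R : ℝ} (hr : 0 ≤ r)
    (h : Metric.closedBall c r ⊆ Metric.closedBall z R) : r + dist c z ≤ R := by
  rcases eq_or_ne c z with rfl | hne
  · have hmem : c + EuclideanSpace.single 0 r ∈ Metric.closedBall c r := by
      simp [abs_of_nonneg hr]
    have := h hmem
    simpa [abs_of_nonneg hr] using this
  · have hD : 0 < dist z c := dist_pos.mpr hne.symm
    have hq : 0 ≤ r / dist z c := by positivity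
    have hmem : AffineMap.lineMap z c (1 + r / dist z c) ∈ Metric.closedBall c r := by
      rw [Metric.mem_closedBall, dist_lineMap_right, Real.norm_eq_abs, sub_add_cancel_left, abs_neg,
        abs_of_nonneg hq, div_mul_cancel₀ _ hD.ne']
    have := h hmem
    rw [Metric.mem_closedBall, dist_lineMap_left, Real.norm_eq_abs, abs_of_nonneg (by linarith),
      add_mul, div_mul_cancel₀ _ hD.ne', one_mul] at this
    rw [dist_comm]
    linarith

theorem add_le_dist_of_forall_closedBall {c z : E3} {a R : ℝ} (ha : 0 < a) (hR : 0 ≤ R)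
    (h : ∀ x ∈ Metric.closedBall z R, a ≤ dist c x) : a + R ≤ dist c z := by
  rcases le_or_gt (dist c z) R with hle | hlt
  · have := h c hle
    rw [dist_self] at this
    linarith
  · have hD : 0 < dist z c := by rw [dist_comm]; linarith
    have hq : R / dist z c ≤ 1 := by rw [div_le_one hD, dist_comm]; exact hlt.le
    have hmem : AffineMap.lineMap z c (R / dist z c) ∈ Metric.closedBall z R := by
      rw [Metric.mem_closedBall, dist_lineMap_left, Real.norm_eq_abs,
        abs_of_nonneg (by positivity), div_mul_cancel₀ _ hD.ne']
    have := h _ hmem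
    rw [dist_right_lineMap, Real.norm_eq_abs, abs_of_nonneg (by linarith), sub_mul,
      div_mul_cancel₀ _ hD.ne', one_mul, dist_comm z c] at this
    linarith

/-! ### Translation invariance -/

theorem evalLocal_sub_sub (q : ℕ) (B : Coeffs) (c t z : E3) :
    evalLocal q B (c - z) (t - z) = evalLocal q B c t := by
  simp only [evalLocal, sub_sub_sub_cancel_right]

theorem sourceToLocal_sub_sub (q : ℕ) (s c z : E3) :
    sourceToLocal q (s - z) (c - z) = sourceToLocal q s c := by
  simp only [sourceToLocal, sub_sub_sub_cancel_right]

theorem sourceToMultipole_sub_sub (q : ℕ) (s c z : E3) :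
    sourceToMultipole q (s - z) (c - z) = sourceToMultipole q s c := by
  simp only [sourceToMultipole, sub_sub_sub_cancel_right]

theorem multipoleToLocal_sub_sub (c c' z : E3) (p q : ℕ) (B : Coeffs) :
    multipoleToLocal (c - z) (c' - z) p q B = multipoleToLocal c c' p q B := by
  simp only [multipoleToLocal, sub_sub_sub_cancel_right]

theorem localToLocal_sub_sub (c c' z : E3) (p q : ℕ) (B : Coeffs) :
    localToLocal (c - z) (c' - z) p q B = localToLocal c c' p q B := by
  simp only [localToLocal, sub_sub_sub_cancel_right]

theorem one_div_four_pi_le_one : 1 / (4 * Real.pi) ≤ 1 := by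
  rw [div_le_one (by positivity)]
  linarith [Real.pi_gt_three]

theorem sqrt_three_bounds : 1.73 < √3 ∧ √3 < 1.74 := by
  constructor
  · exact Real.lt_sqrt_of_sq_lt (by norm_num)
  · rw [Real.sqrt_lt' (by norm_num)]; norm_num

/-- The error bound for the chain source → multipole(`p`) → local(`q`), with constant `C`. The ball
of targets has an arbitrary center `z`, and the evaluation ball about `c'` lies in it. -/
def MultipoleBound (C : ℝ) : Prop :=
    ∀ (R ρ r : ℝ) (z s c c' t : E3) (p q : ℕ),
      0 < R → 0 < r → r < ρ → dist c z = R + ρ → dist s c ≤ r → dist c' t + dist c' z ≤ R →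
      ‖evalLocal q (multipoleToLocal c c' p q (sourceToMultipole p s c)) c' t -
        evalLocal q (sourceToLocal q s c') c' t‖ ≤ C / (ρ - r) * (r / ρ) ^ (p + 1)

/-- The error bound for the chain source → local(`p`) → local(`q`), with constant `C` and an
arbitrary center `z` of the intermediate expansion. Here and in the other two bounds the factor
`1 / (4π)` is estimated by `1`. -/
def LocalBound (C : ℝ) : Prop :=
    ∀ (ρ r : ℝ) (z s c t : E3) (p q : ℕ),
      0 < r → r < ρ → dist s z = ρ → dist c t + dist c z ≤ r →
      ‖evalLocal q (localToLocal z c p q (sourceToLocal p s z)) c t -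
        evalLocal q (sourceToLocal q s c) c t‖ ≤ C / (ρ - r) * (r / ρ) ^ (p + 1)

/-- The error bound for the chain source → multipole(`p`) → local(`p`) → local(`q`), with constant
`C` and an arbitrary center `z` of the intermediate local expansion. -/
def MultipoleToLocalBound (C : ℝ) : Prop :=
    ∀ (R ρ r : ℝ) (z s c c' t : E3) (p q : ℕ),
      0 < R → 0 < r → r < ρ → dist c z = R + ρ → dist s c ≤ r → dist c' t + dist c' z ≤ R →
      ‖evalLocal q (localToLocal z c' p q
            (multipoleToLocal c z p p (sourceToMultipole p s c))) c' t -
        evalLocal q (sourceToLocal q s c') c' t‖ ≤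
      C / (ρ - r) * ((R / (R + (ρ - r))) ^ (p + 1) + (r / ρ) ^ (p + 1))

theorem MultipoleAccuracy.translated (h : MultipoleAccuracy) :
    ∃ C : ℝ, 0 < C ∧ MultipoleBound C := by
  obtain ⟨C, hC, h⟩ := h
  refine ⟨C, hC, fun R ρ r z s c c' t p q hR hr hρ hc hs ht => ?_⟩
  have ht0 : 0 ≤ dist c' t := dist_nonneg
  have key := h R ρ r (s - z) (c - z) (c' - z) (t - z) p q hR hr hρ
    (by rw [← dist_eq_norm, hc])
    (by rwa [sub_sub_sub_cancel_right, ← dist_eq_norm])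
    (by rw [← dist_eq_norm]; linarith)
    (by rw [sub_sub_sub_cancel_right, ← dist_eq_norm, ← dist_eq_norm]; linarith)
  rw [evalLocal_sub_sub, evalLocal_sub_sub, sourceToLocal_sub_sub, sourceToMultipole_sub_sub,
    multipoleToLocal_sub_sub] at key
  refine key.trans ?_
  have h1 : 0 ≤ C / (ρ - r) := by
    have : 0 < ρ - r := by linarith
    positivity
  have h2 : 0 ≤ (r / ρ) ^ (p + 1) := by
    have : 0 < ρ := by linarith
    positivity
  exact mul_le_mul_of_nonneg_right (mul_le_of_le_one_left h1 one_div_four_pi_le_one) h2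

theorem LocalAccuracy.translated (h : LocalAccuracy) :
    ∃ C : ℝ, 0 < C ∧ LocalBound C := by
  obtain ⟨C, hC, h⟩ := h
  refine ⟨C, hC, fun ρ r z s c t p q hr hρ hs ht => ?_⟩
  have ht0 : 0 ≤ dist c t := dist_nonneg
  have htz : dist t z ≤ r := by
    have := dist_triangle t c z
    rw [dist_comm t c] at this
    linarith
  have key := h ρ r (s - z) (c - z) (t - z) p q hr hρ
    (by rw [← dist_eq_norm, hs])
    (by rw [← dist_eq_norm]; linarith)
    (by rwa [← dist_eq_norm])
    (by rw [sub_sub_sub_cancel_right, ← dist_eq_norm, ← dist_eq_norm, dist_comm t c]; linarith)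
  rw [evalLocal_sub_sub, evalLocal_sub_sub, sourceToLocal_sub_sub, ← sub_self z,
    sourceToLocal_sub_sub, localToLocal_sub_sub] at key
  refine key.trans ?_
  have h1 : 0 ≤ C / (ρ - r) := by
    have : 0 < ρ - r := by linarith
    positivity
  have h2 : 0 ≤ (r / ρ) ^ (p + 1) := by
    have : 0 < ρ := by linarith
    positivity
  exact mul_le_mul_of_nonneg_right (mul_le_of_le_one_left h1 one_div_four_pi_le_one) h2

theorem MultipoleToLocalAccuracy.translated (h : MultipoleToLocalAccuracy) :
    ∃ C : ℝ, 0 < C ∧ MultipoleToLocalBound C := by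
  obtain ⟨C, hC, h⟩ := h
  refine ⟨C, hC, fun R ρ r z s c c' t p q hR hr hρ hc hs ht => ?_⟩
  have ht0 : 0 ≤ dist c' t := dist_nonneg
  have key := h R ρ r (s - z) (c - z) (c' - z) (t - z) p q hR hr hρ
    (by rw [← dist_eq_norm, hc])
    (by rwa [sub_sub_sub_cancel_right, ← dist_eq_norm])
    (by rw [← dist_eq_norm]; linarith)
    (by rw [sub_sub_sub_cancel_right, ← dist_eq_norm, ← dist_eq_norm]; linarith)
  rw [evalLocal_sub_sub, evalLocal_sub_sub, sourceToLocal_sub_sub, sourceToMultipole_sub_sub,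
    ← sub_self z, localToLocal_sub_sub, multipoleToLocal_sub_sub] at key
  refine key.trans ?_
  have h0 : 0 < ρ - r := by linarith
  have h1 : 0 ≤ C / (ρ - r) := by positivity
  have h2 : 0 ≤ (R / (R + (ρ - r))) ^ (p + 1) + (r / ρ) ^ (p + 1) := by
    have : 0 < ρ := by linarith
    positivity
  have h3 : C / (4 * Real.pi) * (1 / (ρ - r) * (R / (R + (ρ - r))) ^ (p + 1) +
      1 / (ρ - r) * (r / ρ) ^ (p + 1)) = 1 / (4 * Real.pi) * (C / (ρ - r)) *
      ((R / (R + (ρ - r))) ^ (p + 1) + (r / ρ) ^ (p + 1)) := by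
    have := Real.pi_pos
    field_simp
  rw [h3]
  exact mul_le_mul_of_nonneg_right (mul_le_of_le_one_left h1 one_div_four_pi_le_one) h2

/-! ### The rate of convergence -/

/-- The base of the geometric convergence. -/
noncomputable def rate (tf : ℝ) : ℝ := max (√3 * (1 + tf) / (6 - √3)) (√3 / 3)

/-- The relative separation `ω`. -/
noncomputable def sep (tf : ℝ) : ℝ := min (3 - √3) (6 - 2 * √3 - √3 * tf)

theorem sep_pos {tf : ℝ} (h : tf < 2 * √3 - 2) : 0 < sep tf := by
  have h3 : √3 * √3 = 3 := Real.mul_self_sqrt (by norm_num)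
  have hb := sqrt_three_bounds
  refine lt_min (by linarith) ?_
  nlinarith

theorem rate_le {tf : ℝ} (h : tf ≤ (6 * √3 - 7) / 4) : rate tf ≤ 3 / 4 := by
  have h3 : √3 * √3 = 3 := Real.mul_self_sqrt (by norm_num)
  have hb := sqrt_three_bounds
  refine max_le ?_ (by linarith)
  rw [div_le_iff₀ (by linarith)]
  nlinarith

/-- The second ratio in the multipole-to-local bound never exceeds the first: their comparison
reduces to `(u - 1) (2√3 - 1 - u) ≥ 0` for `u = 1 + tf`. -/
theorem second_ratio_le {tf : ℝ} (h0 : 0 ≤ tf) (h : tf < 2 * √3 - 2) :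
    √3 / (6 - √3 * (1 + tf)) ≤ √3 * (1 + tf) / (6 - √3) := by
  have h3 : √3 * √3 = 3 := Real.mul_self_sqrt (by norm_num)
  have hb := sqrt_three_bounds
  have hpos : 0 < 6 - √3 * (1 + tf) := by nlinarith
  rw [div_le_div_iff₀ hpos (by linarith), mul_assoc]
  refine mul_le_mul_of_nonneg_left ?_ (Real.sqrt_nonneg 3)
  have : 0 ≤ √3 * (tf * (2 * √3 - 2 - tf)) := by
    have : 0 ≤ 2 * √3 - 2 - tf := by linarith
    positivity
  nlinarith

/-- Monotonicity of the error bounds in the separation, the ratio and the constant. -/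
theorem div_mul_pow_le {C M x y a b : ℝ} (hC : 0 ≤ C) (hCM : C ≤ M) (hy : 0 < y) (hyx : y ≤ x)
    (ha : 0 ≤ a) (hab : a ≤ b) (n : ℕ) : C / x * a ^ n ≤ M / y * b ^ n := by
  have hM : 0 ≤ M := hC.trans hCM
  gcongr

theorem sep_mul_le {tf m x y : ℝ} (htf : tf < 2 * √3 - 2) (hm : m ≤ x)
    (h : sep tf * x ≤ y) : sep tf * m ≤ y :=
  (mul_le_mul_of_nonneg_left hm (sep_pos htf).le).trans h

/-! ### Errors of the individual far interactions -/

namespace Octree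

variable (T : Octree)

/-- The ball about `c` that reaches `t` lies in the target confinement region of `b`. -/
def Confined (tf : ℝ) (b : Box) (c t : E3) : Prop :=
  dist c t + dist c (T.center b) ≤ √3 * T.radius b * (1 + tf)

variable {T}

theorem Confined.of_isChild {tf : ℝ} (htf : 0 ≤ tf) {d e : Box} {c t : E3} (h : d.IsChild e)
    (hd : T.Confined tf d c t) : T.Confined tf e c t := by
  rw [Confined] at hd ⊢
  rw [T.radius_of_isChild h]
  have h1 := dist_le_sqrt_three_mul (T.center d) (T.center e)
  have h2 := T.linfDist_center_of_isChild h
  have h3 : √3 * linfDist (T.center d) (T.center e) ≤ √3 * T.radius d := by gcongr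
  have h4 : 0 ≤ √3 * T.radius d * tf := by have := T.radius_pos d; positivity
  have h5 := dist_triangle c (T.center d) (T.center e)
  linarith

theorem Confined.up {tf : ℝ} (htf : 0 ≤ tf) {b : Box} {c t : E3} {l : ℕ} (hl : l ≤ b.level)
    (hb : T.Confined tf b c t) : T.Confined tf (b.up l) c t := by
  induction hl using Nat.decreasingInduction with
  | self => simpa using hb
  | of_succ l hl ih => exact ih.of_isChild htf (Box.up_isChild hl)

theorem dist_center_le {b : Box} {y : E3} (hy : y ∈ T.region b) :
    dist y (T.center b) ≤ √3 * T.radius b :=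
  (dist_le_sqrt_three_mul _ _).trans (mul_le_mul_of_nonneg_left hy (Real.sqrt_nonneg 3))

/-- A List 3 far multipole expansion converges at the targets of `b`. -/
theorem list3far_ratio {tf : ℝ} (htf : 0 ≤ tf) (htf' : tf < 2 * √3 - 2) {d b : Box}
    (hd : d ∈ T.boxes) (h : T.BoxSepTCR tf d b) :
    ∃ R ρ r : ℝ, R = √3 * T.radius b * (1 + tf) ∧ r = √3 * T.radius d ∧ 0 < R ∧ 0 < r ∧ r < ρ ∧
      dist (T.center d) (T.center b) = R + ρ ∧ sep tf * T.minRadius ≤ ρ - r ∧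
      r / ρ ≤ rate tf := by
  have hr := T.radius_pos d
  have hrb := T.radius_pos b
  have hb := sqrt_three_bounds
  have hR : 0 < √3 * T.radius b * (1 + tf) := by positivity
  have hD := add_le_dist_of_forall_closedBall (by positivity : 0 < 3 * T.radius d) hR.le h
  have hρ : 3 * T.radius d ≤ dist (T.center d) (T.center b) - √3 * T.radius b * (1 + tf) := by
    linarith
  refine ⟨_, dist (T.center d) (T.center b) - √3 * T.radius b * (1 + tf), _, rfl, rfl, hR,
    by positivity, ?_, by ring, ?_, ?_⟩
  · nlinarith
  · refine sep_mul_le htf' (T.minRadius_le hd) ?_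
    have : sep tf * T.radius d ≤ (3 - √3) * T.radius d := by
      gcongr; exact min_le_left _ _
    linarith
  · refine le_trans ?_ (le_max_right _ _)
    rw [div_le_div_iff₀ (by linarith) (by norm_num), mul_assoc]
    exact mul_le_mul_of_nonneg_left (by linarith) (Real.sqrt_nonneg 3)

/-- The local expansion of a List 4 far source converges in the target confinement region. -/
theorem list4far_ratio {tf : ℝ} (htf : 0 ≤ tf) (htf' : tf < 2 * √3 - 2) {w s : Box}
    (hw : w ∈ T.boxes) (h : T.TCRSepBox tf w s) {y : E3} (hy : y ∈ T.region s) :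
    ∃ ρ r : ℝ, r = √3 * T.radius w * (1 + tf) ∧ 0 < r ∧ r < ρ ∧
      dist y (T.center w) = ρ ∧ sep tf * T.minRadius ≤ ρ - r ∧ r / ρ ≤ rate tf := by
  have hr := T.radius_pos w
  have hb := sqrt_three_bounds
  have hR : 0 < T.radius w * (1 + tf) := by positivity
  have hρ : 3 * (T.radius w * (1 + tf)) ≤ dist y (T.center w) := by
    rw [dist_comm]
    linarith [h y hy, linfDist_le_dist (T.center w) y]
  refine ⟨_, _, rfl, by positivity, ?_, rfl, ?_, ?_⟩
  · nlinarith
  · refine sep_mul_le htf' (T.minRadius_le hw) ?_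
    have h1 : sep tf * T.radius w ≤ (3 - √3) * T.radius w := by
      gcongr; exact min_le_left _ _
    have h2 : (3 - √3) * T.radius w ≤ (3 - √3) * (T.radius w * (1 + tf)) := by
      refine mul_le_mul_of_nonneg_left ?_ (by linarith)
      nlinarith
    linarith
  · refine le_trans ?_ (le_max_right _ _)
    rw [div_le_div_iff₀ (by linarith) (by norm_num), mul_assoc, mul_assoc]
    exact mul_le_mul_of_nonneg_left (by linarith) (Real.sqrt_nonneg 3)

theorem six_mul_radius_le_dist {w d : Box} (hd : d ∈ T.boxes) (h : T.WellSeparated 2 w d) :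
    6 * T.radius w ≤ dist (T.center d) (T.center w) := by
  obtain ⟨hl, hc⟩ := h
  rw [T.colleague_two_iff hd hl] at hc
  push Not at hc
  obtain ⟨i, hi⟩ := hc
  have h1 : |T.center d i - T.center w i| ≤ dist (T.center d) (T.center w) := by
    rw [dist_eq_norm]
    exact PiLp.norm_apply_le (T.center d - T.center w) i
  have hr := T.radius_pos w
  have h2 : (3 : ℝ) ≤ |((d.idx i - w.idx i : ℤ) : ℝ)| := by
    rw [← Int.cast_abs, abs_sub_comm]
    exact_mod_cast hi
  rw [T.center_sub_center hl i, abs_mul, abs_of_pos (by positivity)] at h1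
  nlinarith

/-- The multipole-to-local conversion of a List 2 box converges. -/
theorem list2_ratio {tf : ℝ} (htf : 0 ≤ tf) (htf' : tf < 2 * √3 - 2) {w d : Box}
    (hw : w ∈ T.boxes) (hd : d ∈ T.boxes) (h : T.WellSeparated 2 w d) :
    ∃ R ρ r : ℝ, R = √3 * T.radius w * (1 + tf) ∧ r = √3 * T.radius d ∧ 0 < R ∧ 0 < r ∧ r < ρ ∧
      dist (T.center d) (T.center w) = R + ρ ∧ sep tf * T.minRadius ≤ ρ - r ∧
      R / (R + (ρ - r)) ≤ rate tf ∧ r / ρ ≤ rate tf := by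
  have hr := T.radius_pos w
  have hb := sqrt_three_bounds
  have h3 : √3 * √3 = 3 := Real.mul_self_sqrt (by norm_num)
  have hD := six_mul_radius_le_dist hd h
  have hrad : T.radius d = T.radius w := T.radius_eq_of_level h.1
  have hR : 0 < √3 * T.radius w * (1 + tf) := by positivity
  set D := dist (T.center d) (T.center w)
  have hu : 0 < 6 - √3 * (1 + tf) := by nlinarith
  have hρ : (6 - √3 * (1 + tf)) * T.radius w ≤ D - √3 * T.radius w * (1 + tf) := by
    linarith
  have hgap : sep tf * T.radius w ≤ D - √3 * T.radius w * (1 + tf) - √3 * T.radius d := by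
    have : sep tf * T.radius w ≤ (6 - 2 * √3 - √3 * tf) * T.radius w := by
      gcongr; exact min_le_right _ _
    rw [hrad]
    linarith
  have hgap0 : 0 < sep tf * T.radius w := mul_pos (sep_pos htf') hr
  refine ⟨_, D - √3 * T.radius w * (1 + tf), _, rfl, rfl, hR, ?_, by linarith, by ring,
    sep_mul_le htf' (T.minRadius_le hw) hgap, ?_, ?_⟩
  · rw [hrad]; positivity
  · refine le_trans ?_ (le_max_left _ _)
    rw [hrad] at hgap ⊢
    rw [div_le_div_iff₀ (by linarith) (by linarith)]
    have h1 : (6 - √3) * T.radius w ≤ D - √3 * T.radius w := by linarith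
    have h2 : 0 ≤ √3 * (1 + tf) := by positivity
    have := mul_le_mul_of_nonneg_left h1 h2
    linarith
  · refine le_trans ?_ ((second_ratio_le htf htf').trans (le_max_left _ _))
    rw [hrad, div_le_div_iff₀ (by nlinarith) hu, mul_assoc]
    exact mul_le_mul_of_nonneg_left (by linarith) (Real.sqrt_nonneg 3)

end Octree

theorem norm_ind_smul_le {P : Prop} {x : ℂ} {B : ℝ} (h : P → ‖x‖ ≤ B) :
    ‖ind P • x‖ ≤ ind P * B := by
  by_cases hP : P
  · rw [ind_of hP, one_smul, Nat.cast_one, one_mul]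
    exact h hP
  · simp [ind_of_not hP]

namespace FMMTree

variable {Γ : Set E3} {X : QBXData Γ} {tf : ℝ} (T : FMMTree X tf)

/-- The error due to one unit source. As the source is accounted for exactly once, the error is that
of a single far interaction, or zero. -/
theorem unit_error (htf : 0 ≤ tf) {p q : ℕ} {b s : Box} {y c t : E3} {B : ℝ} (hB : 0 ≤ B)
    (hb : b ∈ T.boxes) (hs : T.IsLeaf s) (hsrc : T.IsSourceBox s)
    (h3 : ∀ d ∈ T.list3far b, d.Covers s →
      ‖evalLocal q (multipoleToLocal (T.center d) c p q (sourceToMultipole p y (T.center d))) c t -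
        evalLocal q (sourceToLocal q y c) c t‖ ≤ B)
    (h2 : ∀ l ≤ b.level, ∀ d ∈ T.list2 (b.up l), d.Covers s →
      ‖evalLocal q (localToLocal (T.center (b.up l)) c p q (multipoleToLocal (T.center d)
          (T.center (b.up l)) p p (sourceToMultipole p y (T.center d)))) c t -
        evalLocal q (sourceToLocal q y c) c t‖ ≤ B)
    (h4 : ∀ l ≤ b.level, s ∈ T.list4far (b.up l) →
      ‖evalLocal q (localToLocal (T.center (b.up l)) c p q
          (sourceToLocal p y (T.center (b.up l)))) c t -
        evalLocal q (sourceToLocal q y c) c t‖ ≤ B) :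
    ‖evalLocal q (T.unitCoeffs p q s y b c) c t - evalLocal q (sourceToLocal q y c) c t‖ ≤ B := by
  have hcount := T.interaction_count htf hb hs hsrc
  set N1 := ind (s ∈ T.list1 b) + ind (s ∈ T.list3close b) + ind (s ∈ T.list4close b)
  set E0 := evalLocal q (sourceToLocal q y c) c t with hE0
  have hval : evalLocal q (T.unitCoeffs p q s y b c) c t = N1 • E0 +
      ∑ d ∈ T.list3far b, ind (d.Covers s) • evalLocal q (multipoleToLocal (T.center d) c p q
        (sourceToMultipole p y (T.center d))) c t +
      ∑ l ∈ Finset.range (b.level + 1), (∑ d ∈ T.list2 (b.up l), ind (d.Covers s) •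
        evalLocal q (localToLocal (T.center (b.up l)) c p q (multipoleToLocal (T.center d)
          (T.center (b.up l)) p p (sourceToMultipole p y (T.center d)))) c t +
        ind (s ∈ T.list4far (b.up l)) • evalLocal q (localToLocal (T.center (b.up l)) c p q
          (sourceToLocal p y (T.center (b.up l)))) c t) := by
    have hE : ∀ B, evalLocal q B c t = evalLocalLin q c t B := fun _ => rfl
    have hL : ∀ z B, localToLocal z c p q B = localToLocalLin z c p q B := fun _ _ => rfl
    rw [hE0]
    simp only [hE, hL, unitCoeffs, unitIncoming, map_add, map_sum, map_nsmul]
    rfl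
  have hdiff : evalLocal q (T.unitCoeffs p q s y b c) c t - E0 =
      ∑ d ∈ T.list3far b, ind (d.Covers s) • (evalLocal q (multipoleToLocal (T.center d) c p q
        (sourceToMultipole p y (T.center d))) c t - E0) +
      ∑ l ∈ Finset.range (b.level + 1), (∑ d ∈ T.list2 (b.up l), ind (d.Covers s) •
        (evalLocal q (localToLocal (T.center (b.up l)) c p q (multipoleToLocal (T.center d)
          (T.center (b.up l)) p p (sourceToMultipole p y (T.center d)))) c t - E0) +
        ind (s ∈ T.list4far (b.up l)) • (evalLocal q (localToLocal (T.center (b.up l)) c p q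
          (sourceToLocal p y (T.center (b.up l)))) c t - E0)) := by
    have h1 : E0 = (N1 + ∑ d ∈ T.list3far b, ind (d.Covers s) +
      ∑ l ∈ Finset.range (b.level + 1), (∑ d ∈ T.list2 (b.up l), ind (d.Covers s) +
        ind (s ∈ T.list4far (b.up l)))) • E0 := by rw [hcount, one_smul]
    rw [hval]
    simp only [smul_sub, Finset.sum_sub_distrib, Finset.sum_add_distrib]
    simp only [add_smul, Finset.sum_smul, Finset.sum_add_distrib] at h1
    linear_combination -h1
  rw [hdiff]
  have hn3 : ‖∑ d ∈ T.list3far b, ind (d.Covers s) • (evalLocal q (multipoleToLocal (T.center d) c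
      p q (sourceToMultipole p y (T.center d))) c t - E0)‖ ≤
      ((∑ d ∈ T.list3far b, ind (d.Covers s) : ℕ) : ℝ) * B := by
    rw [Nat.cast_sum, Finset.sum_mul]
    exact norm_sum_le_of_le _ fun d hd => norm_ind_smul_le (h3 d hd)
  have hn2 : ‖∑ l ∈ Finset.range (b.level + 1), (∑ d ∈ T.list2 (b.up l), ind (d.Covers s) •
        (evalLocal q (localToLocal (T.center (b.up l)) c p q (multipoleToLocal (T.center d)
          (T.center (b.up l)) p p (sourceToMultipole p y (T.center d)))) c t - E0) +
        ind (s ∈ T.list4far (b.up l)) • (evalLocal q (localToLocal (T.center (b.up l)) c p q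
          (sourceToLocal p y (T.center (b.up l)))) c t - E0))‖ ≤
      ((∑ l ∈ Finset.range (b.level + 1), (∑ d ∈ T.list2 (b.up l), ind (d.Covers s) +
        ind (s ∈ T.list4far (b.up l))) : ℕ) : ℝ) * B := by
    rw [Nat.cast_sum, Finset.sum_mul]
    refine norm_sum_le_of_le _ fun l hl => ?_
    have hl' : l ≤ b.level := Nat.lt_succ_iff.mp (Finset.mem_range.mp hl)
    rw [Nat.cast_add, add_mul, Nat.cast_sum, Finset.sum_mul]
    exact norm_add_le_of_le (norm_sum_le_of_le _ fun d hd => norm_ind_smul_le (h2 l hl' d hd))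
      (norm_ind_smul_le (h4 l hl'))
  refine (norm_add_le_of_le hn3 hn2).trans ?_
  rw [← add_mul, ← Nat.cast_add]
  refine mul_le_of_le_one_left hB ?_
  exact_mod_cast (by omega)

/-- The error at an evaluation point `t` of the expansion at `c`. -/
theorem qbxCoeffs_error {C₁ C₂ C₃ : ℝ}
    (hC₁ : 0 < C₁) (hC₂ : 0 < C₂) (hC₃ : 0 < C₃)
    (h₁ : MultipoleBound C₁)
    (h₂ : LocalBound C₂)
    (h₃ : MultipoleToLocalBound C₃)
    (htf : 0 ≤ tf) (htf' : tf < 2 * √3 - 2) (p q : ℕ) (g : Fin X.numSources → ℝ) {b : Box}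
    (hb : b ∈ T.boxes) {c t : E3} (hct : T.Confined tf b c t) :
    ‖evalLocal q (∑ i, (g i : ℂ) • sourceToLocal q (X.source i) c) c t -
        evalLocal q (T.qbxCoeffs p q g b c) c t‖ ≤
      (∑ i, |g i|) * ((C₁ + C₂ + 2 * C₃) / (sep tf * T.minRadius) * rate tf ^ (p + 1)) := by
  have hsm : 0 < sep tf * T.minRadius := mul_pos (sep_pos htf') T.minRadius_pos
  have hrate : 0 ≤ rate tf := le_max_of_le_right (by positivity)
  set B := (C₁ + C₂ + 2 * C₃) / (sep tf * T.minRadius) * rate tf ^ (p + 1) with hBdef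
  have hB : 0 ≤ B := by positivity
  have hE : ∀ B, evalLocal q B c t = evalLocalLin q c t B := fun _ => rfl
  rw [qbxCoeffs_eq, hE, hE, ← map_sub, ← Finset.sum_sub_distrib, map_sum, Finset.sum_mul]
  refine norm_sum_le_of_le _ fun i _ => ?_
  rw [← smul_sub, map_smul, norm_smul, Complex.norm_real, Real.norm_eq_abs, map_sub,
    norm_sub_rev, ← hE, ← hE]
  refine mul_le_mul_of_nonneg_left ?_ (abs_nonneg _)
  refine T.unit_error htf hB hb (T.source_leaf i) ⟨i, rfl⟩ ?_ ?_ ?_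
  · intro d hd hcov
    classical
    rw [list3far, Finset.mem_filter] at hd
    obtain ⟨R, ρ, r, hR, hr, hR0, hr0, hρ, hD, hgap, hratio⟩ :=
      Octree.list3far_ratio htf htf' hd.1 hd.2.2.1
    have hy := Octree.dist_center_le (T.region_subset_of_covers hcov (T.source_mem i))
    refine (h₁ R ρ r _ _ _ c t p q hR0 hr0 hρ hD (hr ▸ hy) (hR ▸ hct)).trans ?_
    exact div_mul_pow_le hC₁.le (by linarith) hsm hgap
      (div_nonneg hr0.le (hr0.trans hρ).le) hratio _
  · intro l hl d hd hcov
    classical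
    rw [list2, Finset.mem_filter] at hd
    obtain ⟨R, ρ, r, hR, hr, hR0, hr0, hρ, hD, hgap, hratio, hratio'⟩ :=
      Octree.list2_ratio htf htf' (T.up_mem hb hl) hd.1 hd.2.2.2
    have hy := Octree.dist_center_le (T.region_subset_of_covers hcov (T.source_mem i))
    refine (h₃ R ρ r _ _ _ c t p q hR0 hr0 hρ hD (hr ▸ hy) (hR ▸ hct.up htf hl)).trans ?_
    have e1 := div_mul_pow_le hC₃.le le_rfl hsm hgap
      (div_nonneg hR0.le (by linarith)) hratio (p + 1)
    have e2 := div_mul_pow_le hC₃.le le_rfl hsm hgap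
      (div_nonneg hr0.le (hr0.trans hρ).le) hratio' (p + 1)
    have e3 : C₃ / (sep tf * T.minRadius) * rate tf ^ (p + 1) +
        C₃ / (sep tf * T.minRadius) * rate tf ^ (p + 1) ≤ B := by
      rw [← add_mul, ← add_div, hBdef]
      exact mul_le_mul_of_nonneg_right ((div_le_div_iff_of_pos_right hsm).mpr (by linarith))
        (pow_nonneg hrate _)
    rw [mul_add]
    linarith
  · intro l hl hs
    classical
    rw [list4far, Finset.mem_filter] at hs
    obtain ⟨ρ, r, hr, hr0, hρ, hD, hgap, hratio⟩ :=
      Octree.list4far_ratio htf htf' (T.up_mem hb hl) hs.2.2 (T.source_mem i)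
    refine (h₂ ρ r _ _ c t p q hr0 hρ hD (hr ▸ hct.up htf hl)).trans ?_
    exact div_mul_pow_le hC₂.le (by linarith) hsm hgap
      (div_nonneg hr0.le (hr0.trans hρ).le) hratio _

/-- The unaccelerated and the accelerated potential at any target are the values of two expansions
with a common center, whose evaluation ball is confined. -/
theorem exists_expansion (htf : 0 ≤ tf) (p q : ℕ) (μ : Γ → ℝ) (τ : Fin X.numTargets) :
    ∃ (q' : ℕ) (b : Box) (c t : E3), b ∈ T.boxes ∧ T.Confined tf b c t ∧
      X.qbxPotential q μ τ = evalLocal q' (∑ i, (X.charge μ i : ℂ) •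
        sourceToLocal q' (X.source i) c) c t ∧
      T.fmmPotential p q μ τ = evalLocal q' (T.qbxCoeffs p q' (X.charge μ) b c) c t := by
  rcases hτ : X.assoc τ with _ | j
  · refine ⟨0, T.targetBox τ, X.target τ, X.target τ, (T.target_leaf τ hτ).1, ?_, ?_, ?_⟩
    · rw [Octree.Confined, dist_self, zero_add]
      refine (Octree.dist_center_le (T.target_mem τ hτ)).trans ?_
      have : 0 ≤ √3 * T.radius (T.targetBox τ) * tf := by
        have := T.radius_pos (T.targetBox τ)
        positivity
      linarith
    · change _ = evalLocalLin 0 _ _ _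
      rw [QBXData.qbxPotential, hτ, map_sum]
      refine Finset.sum_congr rfl fun i _ => ?_
      rw [map_smul]
      change _ = _ • evalLocal 0 _ _ _
      rw [evalLocal_sourceToLocal_zero, smul_eq_mul]
    · rw [fmmPotential, hτ]
      exact T.pointValue_eq p _ _ _
  · refine ⟨q, T.centerBox j, X.center j, X.target τ, T.centerBox_mem j, ?_, ?_, ?_⟩
    · have h1 := X.assoc_mem τ j hτ
      rw [Metric.mem_closedBall'] at h1
      have h2 := add_dist_le_of_closedBall_subset (dist_nonneg.trans h1) (T.ball_confined j)
      rw [Octree.Confined]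
      linarith
    · rw [QBXData.qbxPotential, hτ]
    · rw [fmmPotential, hτ]

end FMMTree

theorem sum_abs_charge_le {Γ : Set E3} (X : QBXData Γ) (μ : Γ → ℝ)
    (hμ : BddAbove (Set.range fun y => |μ y|)) : ∑ i, |X.charge μ i| ≤ X.strength μ := by
  rw [QBXData.strength, Finset.mul_sum]
  refine Finset.sum_le_sum fun i _ => ?_
  rw [QBXData.charge, abs_mul, mul_comm]
  exact mul_le_mul_of_nonneg_right (le_ciSup hμ (X.source i)) (abs_nonneg _)

end GigaQBX

theorem theorem1
    (hyp1 : GigaQBX.MultipoleAccuracy)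
    (hyp2 : GigaQBX.LocalAccuracy)
    (hyp3 : GigaQBX.MultipoleToLocalAccuracy) :
    ∃ M : ℝ, 0 < M ∧
      ∀ (tf : ℝ), 0 ≤ tf → tf < 2 * √3 - 2 →
      ∀ (Γ : Set GigaQBX.E3) (μ : Γ → ℝ), BddAbove (Set.range fun y => |μ y|) →
      ∀ (X : GigaQBX.QBXData Γ) (T : GigaQBX.FMMTree X tf) (pFMM pQBX : ℕ)
        (τ : Fin X.numTargets),
        ‖X.qbxPotential pQBX μ τ - T.fmmPotential pFMM pQBX μ τ‖ ≤
            M * X.strength μ / (min (3 - √3) (6 - 2 * √3 - √3 * tf) * T.minRadius) *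
              max (√3 * (1 + tf) / (6 - √3)) (√3 / 3) ^ (pFMM + 1) ∧
        (tf ≤ (6 * √3 - 7) / 4 →
          ‖X.qbxPotential pQBX μ τ - T.fmmPotential pFMM pQBX μ τ‖ ≤
            M * X.strength μ / (min (3 - √3) (6 - 2 * √3 - √3 * tf) * T.minRadius) *
              (3 / 4) ^ (pFMM + 1)) := by
  obtain ⟨C₁, hC₁, h₁⟩ := hyp1.translated
  obtain ⟨C₂, hC₂, h₂⟩ := hyp2.translated
  obtain ⟨C₃, hC₃, h₃⟩ := hyp3.translated
  refine ⟨C₁ + C₂ + 2 * C₃, by positivity, fun tf htf htf' Γ μ hμ X T p q τ => ?_⟩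
  obtain ⟨q', b, c, t, hb, hct, hX, hT⟩ := T.exists_expansion htf p q μ τ
  rw [hX, hT]
  have hsm : 0 < GigaQBX.sep tf * T.minRadius := mul_pos (GigaQBX.sep_pos htf') T.minRadius_pos
  have hrate : 0 ≤ GigaQBX.rate tf := le_max_of_le_right (by positivity)
  have hcharge := GigaQBX.sum_abs_charge_le X μ hμ
  have hS : 0 ≤ X.strength μ := (Finset.sum_nonneg fun i _ => abs_nonneg _).trans hcharge
  have main : _ ≤ (C₁ + C₂ + 2 * C₃) * X.strength μ / (GigaQBX.sep tf * T.minRadius) *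
      GigaQBX.rate tf ^ (p + 1) :=
    calc _ ≤ _ := T.qbxCoeffs_error hC₁ hC₂ hC₃ h₁ h₂ h₃ htf htf' p q' (X.charge μ) hb hct
      _ ≤ X.strength μ * ((C₁ + C₂ + 2 * C₃) / (GigaQBX.sep tf * T.minRadius) *
          GigaQBX.rate tf ^ (p + 1)) := by gcongr
      _ = _ := by ring
  refine ⟨main, fun h => main.trans ?_⟩
  have h34 := GigaQBX.rate_le h
  exact mul_le_mul_of_nonneg_left (pow_le_pow_left₀ hrate h34 _) (by positivity)
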